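/- Let $n,k$ be positive integers. Let $B_n$ be the group of signed permutations, i.e. the permutations of $\{\pm1,\dots,\pm n\}$ commuting with $x\mapsto -x$, with simple generators $s_i=(i,i+1)(-i,-(i+1))$ for $1\le i<n$ and $s_n=(n,-n)$, and let $T$ be the set of all conjugates of $s_1,\dots,s_n$. Let $\ell_T(w)$ be the least length of a word in $T$ with product $w$, write $u\le_T v$ if $\ell_T(v)=\ell_T(u)+\ell_T(u^{-1}v)$, and let $c$ be any Coxeter element of $B_n$ (a conjugate of a product of $s_1,\dots,s_n$, each taken once, in some order). Let $NC^{(k)}(B_n)$ be the set of all sequences $\pi=(\pi_1,\dots,\pi_k)$ in $B_n$ with $1\le_T\pi_1\le_T\pi_2\le_T\cdots\le_T\pi_k\le_T c$. It is ordered by: $\pi\le\mu$ if and only if $\mu_i^{-1}\mu_{i+1}\le_T\pi_i^{-1}\pi_{i+1}$ for all $1\le i\le k$, where $\pi_{k+1}=\mu_{k+1}=c$. Its rank function is $\mathrm{rk}(\pi)=\ell_T(\pi_1)$. For a positive integer $\ell$, an $\ell$-multichain in a poset is a sequence $P_1\le P_2\le\cdots\le P_\ell$ of its elements. The rank-jump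 vector of an $\ell$-multichain in $NC^{(k)}(B_n)$ is $$(r_1-0,\;r_2-r_1,\;\dots,\;r_\ell-r_{\ell-1},\;n-r_\ell),\qquad r_i=\mathrm{rk}(P_i).$$ (1) For all $\ell\ge1$ and all nonnegative integers $j_1,\dots,j_{\ell+1}$ with $j_1+\cdots+j_{\ell+1}=n$, the number of $\ell$-multichains in $NC^{(k)}(B_n)$ with rank-jump vector $(j_1,\dots,j_{\ell+1})$ is $$\binom{n}{j_1}\binom{kn}{j_2}\binom{kn}{j_3}\cdots\binom{kn}{j_{\ell+1}}.$$ (2) For all $\ell\ge1$, the zeta polynomial of $NC^{(k)}(B_n)$ evaluated at $\ell$, that is, the number $\mathcal Z(NC^{(k)}(B_n),\ell)$ of $\ell$-multichains in $NC^{(k)}(B_n)$, is $\binom{(k\ell+1)n}{n}$. (3) For all $0\le i\le n$, the Fuss–Narayana number $\mathrm{Nar}^{(k)}(B_n,i)$, that is, the number of elements of $NC^{(k)}(B_n)$ of rank $i$, is $\binom{n}{i}\binom{kn}{n-i}$. -/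

import Mathlib

/-! ### Absolute order, Coxeter elements and noncrossing partitions

Here `W` is a group and `s : Fin n → W` is the family of its simple generators. -/

namespace FussB

section Absolute

variable {W : Type*} [Group W] {n : ℕ}

/-- The reflections: the closure under conjugation of the set of simple generators. -/
def reflections (s : Fin n → W) : Set W :=
  {t | ∃ (w : W) (i : Fin n), t = w * s i * w⁻¹}

/-- The absolute length: the least length of a word in the reflections whose product is `w`. -/
noncomputable def absLength (s : Fin n → W) (w : W) : ℕ :=
  sInf {r | ∃ L : List W, (∀ t ∈ L, t ∈ reflections s) ∧ L.length = r ∧ L.prod = w}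

/-- The absolute order: `u` is below `v` when `ℓ(v) = ℓ(u) + ℓ(u⁻¹ v)`. -/
def AbsLE (s : Fin n → W) (u v : W) : Prop :=
  absLength s v = absLength s u + absLength s (u⁻¹ * v)

/-- A Coxeter element: any conjugate of a product of all the simple generators, each taken once,
in some order. -/
def IsCoxeterElement (s : Fin n → W) (c : W) : Prop :=
  ∃ (σ : Equiv.Perm (Fin n)) (w : W), c = w * (List.ofFn fun i => s (σ i)).prod * w⁻¹

/-- The noncrossing partitions: the interval from the identity to `c` in the absolute order. -/
def NC (s : Fin n → W) (c : W) : Set W :=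
  {w | AbsLE s 1 w ∧ AbsLE s w c}

/-- The `k`-divisible noncrossing partitions: the multichains `π₁ ≤ π₂ ≤ ⋯ ≤ π_k` of noncrossing
partitions (the entry `π_{i+1}` is `π i`). -/
def NCk (s : Fin n → W) (c : W) (k : ℕ) : Type _ :=
  {π : Fin k → W // (∀ i, π i ∈ NC s c) ∧ ∀ i j : Fin k, (i : ℕ) + 1 = j → AbsLE s (π i) (π j)}

namespace NCk

variable {s : Fin n → W} {c : W} {k : ℕ}

/-- The entries of a multichain counted from `0`, continued by `c` beyond the last one. -/
def entry (π : NCk s c k) (i : ℕ) : W :=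
  if h : i < k then π.1 ⟨i, h⟩ else c

/-- The delta sequence `(π₁⁻¹ π₂, …, π_{k-1}⁻¹ π_k, π_k⁻¹ c)` of a multichain. -/
def delta (π : NCk s c k) (i : Fin k) : W :=
  (π.entry i)⁻¹ * π.entry (i + 1)

/-- The order on `k`-divisible noncrossing partitions: the dual of the componentwise absolute order
on delta sequences. -/
instance : LE (NCk s c k) where
  le π μ := ∀ i : Fin k, AbsLE s (μ.delta i) (π.delta i)

/-- The rank of a `k`-divisible noncrossing partition: the absolute length of its first entry. -/
noncomputable def rk (π : NCk s c k) : ℕ :=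
  absLength s (π.entry 0)

end NCk

/-- The `l`-multichains `P₁ ≤ P₂ ≤ ⋯ ≤ P_l` of elements of an ordered set. -/
def Multichain (X : Type*) [LE X] (l : ℕ) : Type _ :=
  {P : Fin l → X // ∀ i j : Fin l, (i : ℕ) + 1 = j → P i ≤ P j}

/-- The value at `l` of the zeta polynomial of an ordered set: the number of its `l`-multichains. -/
noncomputable def zeta (X : Type*) [LE X] (l : ℕ) : ℕ :=
  Nat.card (Multichain X l)

/-- The rank-jump vector `(r₁ - 0, r₂ - r₁, …, r_l - r_{l-1}, n - r_l)` of an `l`-multichain of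
`k`-divisible noncrossing partitions, where `r_i` is the rank of its `i`-th element and `n` is the
number of simple generators. -/
noncomputable def rankJump {s : Fin n → W} {c : W} {k l : ℕ}
    (P : Multichain (NCk s c k) l) (i : Fin (l + 1)) : ℤ :=
  let r : Fin (l + 2) → ℤ :=
    Fin.cons (α := fun _ => ℤ) 0 (Fin.snoc (α := fun _ => ℤ) (fun a => ((P.1 a).rk : ℤ)) (n : ℤ))
  r i.succ - r i.castSucc

/-- The Fuss–Narayana number: the number of `k`-divisible noncrossing partitions of rank `i`. -/
noncomputable def fussNarayana (s : Fin n → W) (c : W) (k i : ℕ) : ℕ :=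
  Nat.card {π : NCk s c k // π.rk = i}

end Absolute

/-! ### The group of signed permutations

The set `{1, …, n, -1, …, -n}` is `Fin n × ℤˣ`, the pair `(i, ε)` standing for `ε * (i + 1)`. -/

/-- The antipodal map `(1,-1)(2,-2)⋯(n,-n)`. -/
def antipodal (n : ℕ) : Equiv.Perm (Fin n × ℤˣ) :=
  Equiv.prodCongr (Equiv.refl (Fin n)) (Equiv.neg ℤˣ)

/-- The group `B_n` of signed permutations: the permutations commuting with the antipodal map. -/
abbrev B (n : ℕ) : Subgroup (Equiv.Perm (Fin n × ℤˣ)) :=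
  Subgroup.centralizer {antipodal n}

/-- The signed permutation `(i, j)(-i, -j)`. -/
def signedSwap {n : ℕ} (i j : Fin n) : B n :=
  ⟨Equiv.prodCongr (Equiv.swap i j) (Equiv.refl ℤˣ), by
    rw [Subgroup.mem_centralizer_singleton_iff]
    ext x <;> simp [antipodal]⟩

/-- The signed permutation `(i, -i)`. -/
def signChange {n : ℕ} (i : Fin n) : B n :=
  ⟨Equiv.swap (i, 1) (i, -1), by
    rw [Subgroup.mem_centralizer_singleton_iff, Equiv.mul_swap_eq_swap_mul]
    simp [antipodal, Equiv.swap_comm]⟩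

/-- The simple generators of `B_n`: `(i, i+1)(-i, -(i+1))` for `1 ≤ i < n`, and `(n, -n)`. -/
def simpleB (n : ℕ) (i : Fin n) : B n :=
  if h : (i : ℕ) + 1 < n then signedSwap i ⟨i + 1, h⟩ else signChange i

end FussB

/-! Multichains are factorizations. Along a multichain the delta sequences decrease componentwise in
the absolute order, and their componentwise quotients form an array `F a i` (`Multichain.factors`).
Telescoping over `a` and then over `i` gives `c = g * ∏ᵢ ∏ₐ F a i`, where `g` is the first entry of
the lowest element. The rank-jump vector is `(ℓ(g), ∑ᵢ ℓ(F 1 i), ∑ᵢ ℓ(F 2 i), …)`. Conversely, an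
array whose lengths add up to `n` leaves no slack in any triangle inequality, so it comes from a
multichain (`Multichain.exists_factors_eq`).

Such factorizations are counted in the group algebra, graded by a variable `X`. The absolute length
is the codimension of the fixed space (`absLength_eq_codim`). The sum of all `w` weighted by
`(tX)^ℓ(w)` is a product over `j` of factors `1 + t J_j`, with `J_j` the Jucys–Murphy elements
(`lengthGen_succ`). Hence a product of such sums over a list of values `t` is `∏_j φ(J_j)` with `φ =
∏ (1 + t x)` (`prod_map_lengthGen`). It is central, so `c` may be replaced by the standard Coxeter
element.

At the lowest possible degree, multiplication by `J_j` contributes only through the reflections that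
shorten the element, and for products of blocks these cut the cycle ending at `j`. The resulting
recursions are `A = z φ(A)` for positive cycles and `N = 1 + z φ'(A) N` for negative ones
(`gradedCoeff_jmProd`). Lagrange inversion gives `[z^n] N = [x^n] φ^n` (`coeff_markedTree`). For `φ
= (1 + T₀ x) ∏ₐ (1 + Tₐ x)^k` the coefficients of `φ^n` are the products of binomials in (1).
Vandermonde's identity then gives (2), and chains of one element give (3). -/

namespace FussB

/-! ### Signed permutations and their reflections. -/

variable {n : ℕ}

/-- The opposite of a signed index. -/
def bar (x : Fin n × ℤˣ) : Fin n × ℤˣ := (x.1, -x.2)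

@[simp] theorem bar_bar (x : Fin n × ℤˣ) : bar (bar x) = x := by simp [bar]

@[simp] theorem bar_fst (x : Fin n × ℤˣ) : (bar x).1 = x.1 := rfl

@[simp] theorem bar_snd (x : Fin n × ℤˣ) : (bar x).2 = -x.2 := rfl

theorem bar_ne (x : Fin n × ℤˣ) : bar x ≠ x := fun h =>
  units_ne_neg_self x.2 (congrArg Prod.snd h).symm

theorem bar_eq_iff {x y : Fin n × ℤˣ} : bar x = y ↔ x = bar y :=
  ⟨fun h => by rw [← h, bar_bar], fun h => by rw [h, bar_bar]⟩

@[simp] theorem bar_inj {x y : Fin n × ℤˣ} : bar x = bar y ↔ x = y := by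
  rw [bar_eq_iff, bar_bar]

theorem eq_or_eq_bar_of_fst_eq {x y : Fin n × ℤˣ} (h : x.1 = y.1) : x = y ∨ x = bar y := by
  obtain ⟨i, ε⟩ := x
  obtain ⟨j, δ⟩ := y
  obtain rfl : i = j := h
  rcases Int.units_eq_one_or ε with rfl | rfl <;> rcases Int.units_eq_one_or δ with rfl | rfl <;>
    simp [bar]

theorem antipodal_apply (x : Fin n × ℤˣ) : antipodal n x = bar x := rfl

theorem mem_B_iff {w : Equiv.Perm (Fin n × ℤˣ)} : w ∈ B n ↔ ∀ x, w (bar x) = bar (w x) := by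
  rw [Subgroup.mem_centralizer_singleton_iff, Equiv.ext_iff]
  exact forall_congr' fun x => by simp [antipodal_apply]

@[simp] theorem coe_bar (w : B n) (x : Fin n × ℤˣ) : w.1 (bar x) = bar (w.1 x) :=
  mem_B_iff.1 w.2 x

theorem B_ext {u v : B n} (h : ∀ x, u.1 x = v.1 x) : u = v := Subtype.ext (Equiv.ext h)

theorem coe_mul_apply (u v : B n) (x : Fin n × ℤˣ) : (u * v).1 x = u.1 (v.1 x) := rfl

@[simp] theorem coe_inv_coe (u : B n) (x : Fin n × ℤˣ) : (u⁻¹).1 (u.1 x) = x :=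
  Equiv.symm_apply_apply u.1 x

@[simp] theorem coe_coe_inv (u : B n) (x : Fin n × ℤˣ) : u.1 ((u⁻¹).1 x) = x :=
  Equiv.apply_symm_apply u.1 x

/-- The map underlying the reflection exchanging `a` with `b` and `-a` with `-b`. -/
def reflFun (a b x : Fin n × ℤˣ) : Fin n × ℤˣ :=
  if x = a then b else if x = b then a else if x = bar a then bar b else
    if x = bar b then bar a else x

theorem reflFun_involutive (a b : Fin n × ℤˣ) : Function.Involutive (reflFun a b) := by
  intro x
  have := bar_ne a
  have := bar_ne b
  have := bar_bar a
  have := bar_bar b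
  unfold reflFun
  grind

/-- The signed permutation `(a, b)(-a, -b)`; it is the identity if `a = b`, and `(a, -a)` if
`b = -a`. -/
def refl (a b : Fin n × ℤˣ) : B n :=
  ⟨(reflFun_involutive a b).toPerm, by
    rw [mem_B_iff]
    intro x
    have := bar_ne a
    have := bar_ne b
    simp only [Function.Involutive.coe_toPerm, reflFun, bar_eq_iff, bar_bar]
    split_ifs <;> simp_all [bar_eq_iff]⟩

theorem refl_apply (a b x : Fin n × ℤˣ) : (refl a b).1 x = reflFun a b x := rfl

@[simp] theorem refl_left (a b : Fin n × ℤˣ) : (refl a b).1 a = b := by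
  simp [refl_apply, reflFun]

@[simp] theorem refl_right (a b : Fin n × ℤˣ) : (refl a b).1 b = a := by
  simp +contextual [refl_apply, reflFun]

theorem refl_of_ne {a b x : Fin n × ℤˣ} (ha : x.1 ≠ a.1) (hb : x.1 ≠ b.1) :
    (refl a b).1 x = x := by
  rw [refl_apply, reflFun, if_neg, if_neg, if_neg, if_neg] <;> rintro rfl <;> simp at ha hb

@[simp] theorem refl_mul_self (a b : Fin n × ℤˣ) : refl a b * refl a b = 1 :=
  B_ext (reflFun_involutive a b)

@[simp] theorem refl_inv (a b : Fin n × ℤˣ) : (refl a b)⁻¹ = refl a b :=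
  inv_eq_of_mul_eq_one_left (refl_mul_self a b)

@[simp] theorem refl_self (a : Fin n × ℤˣ) : refl a a = 1 := by
  refine B_ext fun x => ?_
  rw [refl_apply, reflFun]
  split_ifs <;> simp_all

theorem refl_comm (a b : Fin n × ℤˣ) : refl a b = refl b a := by
  refine B_ext fun x => ?_
  simp only [refl_apply, reflFun]
  split_ifs <;> simp_all

theorem refl_bar_bar (a b : Fin n × ℤˣ) : refl (bar a) (bar b) = refl a b := by
  refine B_ext fun x => ?_
  have := bar_ne a
  have := bar_ne b
  simp only [refl_apply, reflFun, bar_bar]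
  split_ifs <;> simp_all [bar_eq_iff]

theorem mul_refl (w : B n) (a b : Fin n × ℤˣ) : w * refl a b = refl (w.1 a) (w.1 b) * w := by
  refine B_ext fun x => ?_
  simp only [coe_mul_apply, refl_apply, reflFun, ← coe_bar, w.1.injective.eq_iff]
  split_ifs <;> rfl

theorem conj_refl (w : B n) (a b : Fin n × ℤˣ) : w * refl a b * w⁻¹ = refl (w.1 a) (w.1 b) := by
  rw [mul_refl, mul_inv_cancel_right]

theorem refl_mul_refl_comm {a b c d : Fin n × ℤˣ} (hac : a.1 ≠ c.1) (had : a.1 ≠ d.1)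
    (hbc : b.1 ≠ c.1) (hbd : b.1 ≠ d.1) : Commute (refl a b) (refl c d) := by
  rw [Commute, SemiconjBy, mul_refl, refl_of_ne hac.symm hbc.symm, refl_of_ne had.symm hbd.symm]

/-! ### The simple generators and the reflections -/

theorem signedSwap_eq (i j : Fin n) : signedSwap i j = refl (i, 1) (j, 1) := by
  refine B_ext fun ⟨x, ε⟩ => ?_
  simp only [signedSwap, refl_apply, reflFun, bar, Prod.mk.injEq, Equiv.prodCongr_apply,
    Prod.map, Equiv.refl_apply, Equiv.swap_apply_def]
  rcases Int.units_eq_one_or ε with rfl | rfl <;> grind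

theorem signChange_eq (i : Fin n) : signChange i = refl (i, 1) (i, -1) := by
  refine B_ext fun ⟨x, ε⟩ => ?_
  simp only [signChange, refl_apply, reflFun, bar, Prod.mk.injEq, Equiv.swap_apply_def]
  rcases Int.units_eq_one_or ε with rfl | rfl <;> grind

/-- Provides the conjugation of `refl a b` to a simple generator. The point `b'` is `b` as seen
after exchanging `a` with `(i, 1)`; its absolute value differs from `i`, so the second reflection
does not disturb `(i, 1)`. -/
theorem exists_map_eq {i j : Fin n} (hij : i ≠ j) {a b : Fin n × ℤˣ} (hab : a.1 ≠ b.1) :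
    ∃ w : B n, w.1 (i, 1) = a ∧ w.1 (j, 1) = b := by
  set b' := (refl (i, 1) a).1 b with hb'
  have h : (i : Fin n) ≠ b'.1 := by
    intro h
    rcases eq_or_eq_bar_of_fst_eq (x := (i, 1)) (y := b') h with h | h
    · have h2 := congrArg (refl (i, 1) a).1 h
      rw [hb', ← coe_mul_apply, refl_mul_self, refl_left] at h2
      exact hab (congrArg Prod.fst h2 :)
    · have h2 := congrArg (refl (i, 1) a).1 h
      rw [coe_bar, hb', ← coe_mul_apply, refl_mul_self, refl_left] at h2
      exact hab (congrArg Prod.fst h2 :)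
  refine ⟨refl (i, 1) a * refl (j, 1) b', ?_, ?_⟩
  · rw [coe_mul_apply, refl_of_ne (x := (i, 1)) hij h, refl_left]
  · rw [coe_mul_apply, refl_left, hb', ← coe_mul_apply, refl_mul_self]
    rfl

/-- Sign changes are conjugate to the last simple generator, the other reflections to the first one.
-/
theorem reflections_simpleB_of_ne {a b : Fin n × ℤˣ} (h : a ≠ b) :
    refl a b ∈ reflections (simpleB n) := by
  have hn : 0 < n := a.1.pos
  by_cases hab : a.1 = b.1
  · obtain rfl : b = bar a := (eq_or_eq_bar_of_fst_eq hab.symm).resolve_left h.symm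
    refine ⟨refl (⟨n - 1, by omega⟩, 1) a, ⟨n - 1, by omega⟩, ?_⟩
    rw [simpleB, dif_neg (by simp; omega), signChange_eq, conj_refl, refl_left]
    congr
    rw [show ((⟨n - 1, by omega⟩, -1) : Fin n × ℤˣ) = bar (⟨n - 1, by omega⟩, 1) from rfl, coe_bar,
      refl_left]
  · have h2 : 1 < n := by
      have := a.1.2
      have := b.1.2
      have : a.1.1 ≠ b.1.1 := fun h => hab (Fin.ext h)
      omega
    obtain ⟨w, hwa, hwb⟩ := exists_map_eq (i := ⟨0, hn⟩) (j := ⟨0 + 1, h2⟩) (by simp) hab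
    refine ⟨w, ⟨0, hn⟩, ?_⟩
    rw [simpleB, dif_pos (by simpa using h2), signedSwap_eq, conj_refl, hwa, hwb]

theorem exists_refl_of_mem_reflections {t : B n} (ht : t ∈ reflections (simpleB n)) :
    ∃ a b, a ≠ b ∧ t = refl a b := by
  obtain ⟨w, i, rfl⟩ := ht
  rw [simpleB]
  split_ifs with h
  · rw [signedSwap_eq, conj_refl]
    exact ⟨_, _, by simp [Fin.ext_iff], rfl⟩
  · rw [signChange_eq, conj_refl]
    exact ⟨_, _, by simp, rfl⟩

/-! ### Signed permutations fixing the last indices -/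

/-- The property of fixing all signed indices of absolute value at least `j`. -/
def Fixes (j : ℕ) (w : B n) : Prop := ∀ x : Fin n × ℤˣ, j ≤ x.1 → w.1 x = x

theorem Fixes.mono {i j : ℕ} {w : B n} (h : Fixes i w) (hij : i ≤ j) : Fixes j w :=
  fun x hx => h x (hij.trans hx)

theorem fixes_one (j : ℕ) : Fixes j (1 : B n) := fun _ _ => rfl

theorem Fixes.mul {j : ℕ} {u v : B n} (hu : Fixes j u) (hv : Fixes j v) : Fixes j (u * v) :=
  fun x hx => by rw [coe_mul_apply, hv x hx, hu x hx]

theorem Fixes.inv {j : ℕ} {u : B n} (hu : Fixes j u) : Fixes j u⁻¹ := fun x hx => by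
  conv_lhs => rw [← hu x hx]
  simp

theorem fixes_refl {j : ℕ} {a b : Fin n × ℤˣ} (ha : (a.1 : ℕ) < j) (hb : (b.1 : ℕ) < j) :
    Fixes j (refl a b) := fun x hx =>
  refl_of_ne (fun h => by rw [h] at hx; omega) (fun h => by rw [h] at hx; omega)

theorem Fixes.lt {j : ℕ} {u : B n} (hu : Fixes j u) {x : Fin n × ℤˣ} (hx : (x.1 : ℕ) < j) :
    ((u.1 x).1 : ℕ) < j := by
  by_contra h
  have h2 := hu.inv _ (not_lt.1 h)
  rw [coe_inv_coe] at h2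
  rw [← h2] at h
  exact h hx

theorem fixes_zero_iff {w : B n} : Fixes 0 w ↔ w = 1 :=
  ⟨fun h => B_ext fun x => h x (Nat.zero_le _), fun h => h ▸ fixes_one 0⟩

theorem fixes_top (w : B n) : Fixes n w := fun x hx => absurd x.1.2 (not_lt.2 hx)

theorem fixes_of_succ {j : ℕ} {w : B n} (hw : Fixes (j + 1) w) (y : Fin n × ℤˣ)
    (hy : (y.1 : ℕ) = j) (h : w.1 y = y) : Fixes j w := by
  intro x hx
  rcases hx.lt_or_eq with hx | hx
  · exact hw x hx
  · rcases eq_or_eq_bar_of_fst_eq (x := x) (y := y) (Fin.ext (by omega)) with rfl | rfl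
    · exact h
    · rw [coe_bar, h]

end FussB

namespace FussB

variable {n : ℕ}

/-! ### The absolute length as the codimension of the fixed space -/

/-- The odd functions on the signed indices that are invariant under `w`. -/
def invariants (w : B n) : Submodule ℚ (Fin n × ℤˣ → ℚ) where
  carrier := {f | (∀ x, f (bar x) = -f x) ∧ ∀ x, f (w.1 x) = f x}
  zero_mem' := by simp
  add_mem' := by
    rintro f g ⟨hf, hf'⟩ ⟨hg, hg'⟩
    exact ⟨fun x => by simp [hf, hg, add_comm], fun x => by simp [hf', hg']⟩
  smul_mem' := by
    rintro r f ⟨hf, hf'⟩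
    exact ⟨fun x => by simp [hf], fun x => by simp [hf']⟩

theorem mul_mem_invariants {u v : B n} {f : Fin n × ℤˣ → ℚ} (hu : f ∈ invariants u)
    (hv : f ∈ invariants v) : f ∈ invariants (u * v) :=
  ⟨hu.1, fun x => by rw [coe_mul_apply, hu.2, hv.2]⟩

theorem odd_apply_refl {f : Fin n × ℤˣ → ℚ} (hf : ∀ x, f (bar x) = -f x) {a b : Fin n × ℤˣ}
    (h : f a = f b) (x : Fin n × ℤˣ) : f ((refl a b).1 x) = f x := by
  rw [refl_apply, reflFun]
  split_ifs with h1 h2 h3 h4 <;> simp_all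

/-- Odd functions fixed by `c * refl a b` take the same value at `a` and `b` as soon as some
function fixed by `c` separates `a` from `b`. -/
theorem invariants_mul_refl_apply_eq {c : B n} {a b : Fin n × ℤˣ} {f g : Fin n × ℤˣ → ℚ}
    (hf : f ∈ invariants c) (hab : f a ≠ f b) (hg : g ∈ invariants (c * refl a b)) :
    g a = g b := by
  obtain ⟨hf0, hf⟩ := hf
  obtain ⟨hg0, hg⟩ := hg
  set R := refl a b with hR
  have hRR : ∀ x, R.1 (R.1 x) = x := reflFun_involutive a b
  have hcR : ∀ x, g (c.1 x) = g (R.1 x) := fun x => by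
    rw [← hg (R.1 x), coe_mul_apply, hRR]
  -- Reindexing `∑ g f` by `c` shows that `g ∘ R - g` is orthogonal to `f`; reindexing by `R` then
  -- shows that it is orthogonal to `f ∘ R`.
  have h1 : ∑ x, (g (R.1 x) - g x) * f x = 0 := by
    have : ∑ x, g (c.1 x) * f (c.1 x) = ∑ x, g x * f x :=
      Equiv.sum_comp c.1 fun x => g x * f x
    simp only [hcR, hf] at this
    simp only [sub_mul, Finset.sum_sub_distrib, this, sub_self]
  have h2 : ∑ x, (g (R.1 x) - g x) * f (R.1 x) = 0 := by
    have := Equiv.sum_comp R.1 fun x => (g (R.1 x) - g x) * f (R.1 x)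
    simp only [hRR] at this
    rw [← this, ← neg_eq_zero, ← Finset.sum_neg_distrib, ← h1]
    exact Finset.sum_congr rfl fun x _ => by ring
  -- Some of the four points may coincide, as when `b = bar a`; only `S.card ≠ 0` matters, since all
  -- terms on `S` are equal.
  set S : Finset (Fin n × ℤˣ) := {a, b, bar a, bar b} with hS
  have h3 : ∀ x, (g (R.1 x) - g x) * (f x - f (R.1 x)) =
      if x ∈ S then (g b - g a) * (f a - f b) else 0 := by
    intro x
    split_ifs with h
    · simp only [hS, Finset.mem_insert, Finset.mem_singleton] at h
      rcases h with rfl | rfl | rfl | rfl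
      · rw [hR, refl_left]
      · rw [hR, refl_right]; ring
      · rw [coe_bar, hR, refl_left, hg0, hg0, hf0, hf0]; ring
      · rw [coe_bar, hR, refl_right, hg0, hg0, hf0, hf0]; ring
    · simp only [hS, Finset.mem_insert, Finset.mem_singleton, not_or] at h
      rw [hR, refl_apply, reflFun, if_neg h.1, if_neg h.2.1, if_neg h.2.2.1, if_neg h.2.2.2]
      ring
  have h4 : ∑ x, (g (R.1 x) - g x) * (f x - f (R.1 x)) = 0 := by
    simp only [mul_sub, Finset.sum_sub_distrib, h1, h2, sub_self]
  simp only [h3, Finset.sum_ite_mem, Finset.univ_inter, Finset.sum_const, nsmul_eq_mul] at h4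
  have hc : (S.card : ℚ) ≠ 0 := by
    rw [Nat.cast_ne_zero, Finset.card_ne_zero]
    exact ⟨a, by simp [hS]⟩
  have := (mul_eq_zero.1 ((mul_eq_zero.1 h4).resolve_left hc)).resolve_right (sub_ne_zero.2 hab)
  linarith

/-- The difference of the values at `a` and `b`. -/
def evalSub (a b : Fin n × ℤˣ) : (Fin n × ℤˣ → ℚ) →ₗ[ℚ] ℚ :=
  LinearMap.proj (R := ℚ) (φ := fun _ => ℚ) a - LinearMap.proj (R := ℚ) (φ := fun _ => ℚ) b

theorem evalSub_apply (a b : Fin n × ℤˣ) (f : Fin n × ℤˣ → ℚ) : evalSub a b f = f a - f b := rfl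

theorem invariants_inf_ker_le (c : B n) (a b : Fin n × ℤˣ) :
    invariants c ⊓ LinearMap.ker (evalSub a b) ≤ invariants (c * refl a b) := by
  rintro f ⟨⟨hf0, hf⟩, hk⟩
  rw [SetLike.mem_coe, LinearMap.mem_ker, evalSub_apply, sub_eq_zero] at hk
  exact ⟨hf0, fun x => by rw [coe_mul_apply, hf, odd_apply_refl hf0 hk]⟩

theorem invariants_mul_refl {c : B n} {a b : Fin n × ℤˣ} {f : Fin n × ℤˣ → ℚ}
    (hf : f ∈ invariants c) (hab : f a ≠ f b) :
    invariants (c * refl a b) = invariants c ⊓ LinearMap.ker (evalSub a b) := by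
  refine le_antisymm (fun g hg => ?_) (invariants_inf_ker_le c a b)
  have h := invariants_mul_refl_apply_eq hf hab hg
  refine ⟨⟨hg.1, fun x => ?_⟩, ?_⟩
  · have h2 := hg.2 ((refl a b).1 x)
    rw [coe_mul_apply, ← coe_mul_apply (refl a b), refl_mul_self] at h2
    rw [← odd_apply_refl hg.1 h x, ← h2]
    rfl
  · rw [SetLike.mem_coe, LinearMap.mem_ker, evalSub_apply, h, sub_self]

theorem finrank_inf_ker_add_one {V : Type*} [AddCommGroup V] [Module ℚ V] [FiniteDimensional ℚ V]
    (U : Submodule ℚ V) (ψ : V →ₗ[ℚ] ℚ) {f : V} (hf : f ∈ U) (hψ : ψ f ≠ 0) :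
    Module.finrank ℚ (U ⊓ LinearMap.ker ψ : Submodule ℚ V) + 1 = Module.finrank ℚ U := by
  have h := Module.Dual.finrank_ker_add_one_of_ne_zero (K := ℚ) (f := ψ.comp U.subtype)
    fun h => hψ (by simpa using LinearMap.congr_fun h ⟨f, hf⟩)
  rw [← h, LinearMap.ker_comp]
  congr 1
  have := (Submodule.equivSubtypeMap U ((LinearMap.ker ψ).comap U.subtype)).finrank_eq
  rw [this, Submodule.map_comap_subtype]

theorem finrank_le_inf_ker_add_one {V : Type*} [AddCommGroup V] [Module ℚ V]
    [FiniteDimensional ℚ V] (U : Submodule ℚ V) (ψ : V →ₗ[ℚ] ℚ) :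
    Module.finrank ℚ U ≤ Module.finrank ℚ (U ⊓ LinearMap.ker ψ : Submodule ℚ V) + 1 := by
  by_cases h : ∃ f ∈ U, ψ f ≠ 0
  · obtain ⟨f, hf, hψ⟩ := h
    exact (finrank_inf_ker_add_one U ψ hf hψ).ge
  · push Not at h
    rw [inf_eq_left.2 h]
    exact Nat.le_succ _

/-- The codimension of the space of invariants of `w` in the space of odd functions. -/
noncomputable def codim (w : B n) : ℕ :=
  Module.finrank ℚ (invariants (1 : B n)) - Module.finrank ℚ (invariants w)

theorem invariants_le_one (w : B n) : invariants w ≤ invariants 1 := fun _ hf =>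
  ⟨hf.1, fun _ => rfl⟩

theorem codim_add_finrank (w : B n) :
    codim w + Module.finrank ℚ (invariants w) = Module.finrank ℚ (invariants (1 : B n)) :=
  Nat.sub_add_cancel (Submodule.finrank_mono (invariants_le_one w))

@[simp] theorem codim_one : codim (1 : B n) = 0 := Nat.sub_self _

/-- The criterion for a reflection to lengthen `c`: exhibit an invariant function separating `a`
from `b`. Below, such functions are always of the form `indicator s t`. -/
theorem codim_mul_refl {c : B n} {a b : Fin n × ℤˣ} {f : Fin n × ℤˣ → ℚ}
    (hf : f ∈ invariants c) (hab : f a ≠ f b) : codim (c * refl a b) = codim c + 1 := by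
  have h1 := codim_add_finrank c
  have h2 := codim_add_finrank (c * refl a b)
  rw [invariants_mul_refl hf hab] at h2
  have h3 := finrank_inf_ker_add_one (invariants c) (evalSub a b) hf (sub_ne_zero.2 hab)
  omega

theorem codim_mul_refl_le (c : B n) (a b : Fin n × ℤˣ) : codim (c * refl a b) ≤ codim c + 1 := by
  have h1 := codim_add_finrank c
  have h2 := codim_add_finrank (c * refl a b)
  have h3 := finrank_le_inf_ker_add_one (invariants c) (evalSub a b)
  have h4 := Submodule.finrank_mono (invariants_inf_ker_le c a b)
  omega

theorem codim_le_mul_refl (c : B n) (a b : Fin n × ℤˣ) : codim c ≤ codim (c * refl a b) + 1 := by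
  have := codim_mul_refl_le (c * refl a b) a b
  rwa [mul_assoc, refl_mul_self, mul_one] at this

/-- The odd function with value `1` at the positive indices in `[s, t)` and `0` outside. -/
def indicator (s t : ℕ) (x : Fin n × ℤˣ) : ℚ :=
  if s ≤ (x.1 : ℕ) ∧ (x.1 : ℕ) < t then ((x.2 : ℤ) : ℚ) else 0

theorem indicator_bar (s t : ℕ) (x : Fin n × ℤˣ) :
    indicator s t (bar x) = -indicator s t x := by
  unfold indicator
  by_cases h : s ≤ (x.1 : ℕ) ∧ (x.1 : ℕ) < t
  · rw [bar_fst, if_pos h, if_pos h]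
    simp
  · rw [bar_fst, if_neg h, if_neg h, neg_zero]

theorem Fixes.indicator_mem {s t : ℕ} {w : B n} (hw : Fixes s w) :
    indicator s t ∈ invariants w := by
  refine ⟨indicator_bar s t, fun x => ?_⟩
  by_cases h : s ≤ x.1
  · rw [hw x h]
  · have := hw.lt (not_le.1 h)
    rw [indicator, indicator, if_neg (by omega), if_neg (by omega)]

theorem Fixes.codim_mul_refl {j : ℕ} {w : B n} (hw : Fixes j w) {a b : Fin n × ℤˣ}
    (hb : b.1 = j) (ha : (a.1 : ℕ) ≤ j) (hab : a ≠ b) : codim (w * refl a b) = codim w + 1 := by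
  refine FussB.codim_mul_refl (hw.indicator_mem (t := j + 1)) ?_
  rcases ha.lt_or_eq with h | h
  · rw [indicator, if_neg (by omega), indicator, if_pos (by omega)]
    rcases Int.units_eq_one_or b.2 with h | h <;> simp [h]
  · obtain rfl : a = bar b := (eq_or_eq_bar_of_fst_eq (Fin.ext (by omega))).resolve_left hab
    rw [indicator_bar, indicator, if_pos (by omega)]
    rcases Int.units_eq_one_or b.2 with h | h <;> simp [h] <;> norm_num

/-- A reflection sends the last moved index back to its place, leaving an element that fixes one
more index. By `Fixes.codim_mul_refl` every nontrivial step of this kind costs exactly one unit of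
codimension. -/
theorem exists_word (j : ℕ) : ∀ w : B n, Fixes j w →
    ∃ L : List (B n), (∀ t ∈ L, t ∈ reflections (simpleB n)) ∧ L.length = codim w ∧
      L.prod = w := by
  induction j with
  | zero =>
    intro w hw
    rw [fixes_zero_iff] at hw
    exact ⟨[], by simp, by simp [hw], by simp [hw]⟩
  | succ j ih =>
    intro w hw
    by_cases hj : j < n
    · set b : Fin n × ℤˣ := (⟨j, hj⟩, 1) with hb
      set a := (w⁻¹).1 b with ha
      have hwa : w.1 a = b := coe_coe_inv w b
      have hw' : Fixes j (w * refl a b) := by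
        have haj : (a.1 : ℕ) < j + 1 := hw.inv.lt (by simp [hb])
        refine fixes_of_succ (hw.mul (fixes_refl haj (by simp [hb]))) b (by simp [hb]) ?_
        rw [coe_mul_apply, refl_right, hwa]
      by_cases hab : a = b
      · rw [hab, refl_self, mul_one] at hw'
        exact ih w hw'
      · obtain ⟨L, h1, h2, h3⟩ := ih _ hw'
        have hw2 : w = w * refl a b * refl a b := by rw [mul_assoc, refl_mul_self, mul_one]
        refine ⟨L ++ [refl a b], ?_, ?_, ?_⟩
        · intro t ht
          rcases List.mem_append.1 ht with ht | ht
          · exact h1 t ht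
          · rw [List.mem_singleton.1 ht]
            exact reflections_simpleB_of_ne hab
        · have haj : (a.1 : ℕ) ≤ j := Nat.lt_succ_iff.1 (hw.inv.lt (by simp [hb]))
          conv_rhs => rw [hw2]
          rw [hw'.codim_mul_refl (by simp [hb]) haj hab, List.length_append, h2,
            List.length_singleton]
        · rw [List.prod_append, h3, List.prod_singleton, ← hw2]
    · exact ih w fun x hx => absurd x.1.2 (by omega)

theorem codim_prod_le (L : List (B n)) (hL : ∀ t ∈ L, t ∈ reflections (simpleB n)) :
    codim L.prod ≤ L.length := by
  induction L using List.reverseRecOn with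
  | nil => simp
  | append_singleton L t ih =>
    obtain ⟨a, b, -, rfl⟩ := exists_refl_of_mem_reflections (hL t (by simp))
    rw [List.prod_append, List.prod_singleton, List.length_append, List.length_singleton]
    exact (codim_mul_refl_le _ a b).trans
      (Nat.succ_le_succ (ih fun t ht => hL t (List.mem_append_left _ ht)))

theorem absLength_eq_codim (w : B n) : absLength (simpleB n) w = codim w := by
  obtain ⟨L, h1, h2, h3⟩ := exists_word n w (fixes_top w)
  refine le_antisymm (Nat.sInf_le ⟨L, h1, h2, h3⟩) ?_
  refine le_csInf ⟨_, L, h1, h2, h3⟩ ?_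
  rintro r ⟨L, h1, rfl, rfl⟩
  exact codim_prod_le L h1

end FussB

/-! ### Lagrange inversion for power series. -/

namespace FussB

section Lagrange

open PowerSeries

variable {S : Type*} [CommRing S]

/-- Iterates approximating the solution of `A = z φ(A)`. -/
noncomputable def treeApprox (φ : Polynomial S) : ℕ → S⟦X⟧
  | 0 => 0
  | k + 1 => X * Polynomial.aeval (treeApprox φ k) φ

/-- The power series `A` with `A = z φ(A)`. -/
noncomputable def tree (φ : Polynomial S) : S⟦X⟧ :=
  PowerSeries.mk fun k => coeff k (treeApprox φ k)

theorem aeval_sub_dvd (φ : Polynomial S) (f g : S⟦X⟧) :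
    f - g ∣ Polynomial.aeval f φ - Polynomial.aeval g φ := by
  rw [Polynomial.aeval_def, Polynomial.aeval_def, Polynomial.eval₂_eq_eval_map,
    Polynomial.eval₂_eq_eval_map]
  exact Polynomial.sub_dvd_eval_sub _ _ _

/-- The map `f ↦ X φ(f)` is a contraction: `f - g` divides `φ(f) - φ(g)`, and the factor `X` gains
one more degree of agreement. -/
theorem treeApprox_dvd (φ : Polynomial S) (k : ℕ) :
    X ^ (k + 1) ∣ treeApprox φ (k + 1) - treeApprox φ k := by
  induction k with
  | zero => simp [treeApprox]
  | succ k ih =>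
    rw [treeApprox, treeApprox, ← mul_sub, pow_succ']
    refine mul_dvd_mul_left _ (ih.trans ?_)
    exact aeval_sub_dvd φ _ _

theorem treeApprox_dvd_of_le (φ : Polynomial S) {k m : ℕ} (h : k ≤ m) :
    X ^ (k + 1) ∣ treeApprox φ m - treeApprox φ k := by
  induction m, h using Nat.le_induction with
  | base => simp
  | succ m hkm ih =>
    have := (pow_dvd_pow (X : S⟦X⟧) (Nat.succ_le_succ hkm)).trans (treeApprox_dvd φ m)
    simpa using dvd_add this ih

theorem tree_dvd (φ : Polynomial S) (k : ℕ) : X ^ (k + 1) ∣ tree φ - treeApprox φ k := by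
  rw [X_pow_dvd_iff]
  intro m hm
  have := X_pow_dvd_iff.1 (treeApprox_dvd_of_le φ (Nat.lt_succ_iff.1 hm)) m (Nat.lt_succ_self m)
  rw [map_sub] at this ⊢
  rw [tree, coeff_mk, ← neg_eq_zero, neg_sub, this]

theorem tree_eq (φ : Polynomial S) : tree φ = X * Polynomial.aeval (tree φ) φ := by
  rw [← sub_eq_zero]
  ext k
  have h : X ^ (k + 1) ∣ tree φ - X * Polynomial.aeval (tree φ) φ := by
    have h1 := (pow_dvd_pow (X : S⟦X⟧) (Nat.le_succ (k + 1))).trans (tree_dvd φ (k + 1))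
    have h2 : X ^ (k + 1) ∣ X * Polynomial.aeval (tree φ) φ - treeApprox φ (k + 1) := by
      rw [treeApprox, ← mul_sub]
      refine Dvd.dvd.mul_left ((tree_dvd φ k).trans ?_) _
      exact aeval_sub_dvd φ _ _
    simpa using dvd_sub h1 h2
  rw [X_pow_dvd_iff.1 h k (Nat.lt_succ_self k), map_zero]

theorem X_dvd_tree (φ : Polynomial S) : X ∣ tree φ := ⟨_, tree_eq φ⟩

theorem coeff_zero_tree (φ : Polynomial S) : coeff 0 (tree φ) = 0 := by
  rw [coeff_zero_eq_constantCoeff_apply, ← X_dvd_iff]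
  exact X_dvd_tree φ

/-- The power series `N` with `N = 1 + z φ'(A) N`. -/
noncomputable def markedTree (φ : Polynomial S) : S⟦X⟧ :=
  invOfUnit (1 - X * Polynomial.aeval (tree φ) φ.derivative) 1

theorem markedTree_eq (φ : Polynomial S) :
    markedTree φ = 1 + X * Polynomial.aeval (tree φ) φ.derivative * markedTree φ := by
  have := mul_invOfUnit (1 - X * Polynomial.aeval (tree φ) φ.derivative) 1 (by simp)
  rw [← markedTree, sub_mul, one_mul, sub_eq_iff_eq_add] at this
  exact this

/-- The coefficient of `z ^ (L + 1)` in `z ψ(A) f` as a sum over the coefficients of `ψ`. -/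
theorem coeff_X_mul_aeval_mul (ψ : Polynomial S) (A f : S⟦X⟧) (L : ℕ) :
    coeff (L + 1) (X * Polynomial.aeval A ψ * f) =
      ψ.sum fun p r => r * coeff L (A ^ p * f) := by
  rw [mul_assoc, coeff_succ_X_mul, Polynomial.aeval_eq_sum_range, Finset.sum_mul, map_sum,
    Polynomial.sum_over_range _ (by simp)]
  exact Finset.sum_congr rfl fun p _ => by rw [smul_mul_assoc, coeff_smul, smul_eq_mul]

theorem coeff_tree_pow_self (φ : Polynomial S) (p : ℕ) :
    coeff p (tree φ ^ p) = φ.coeff 0 ^ p := by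
  have h0 : constantCoeff (Polynomial.aeval (tree φ) φ) = φ.coeff 0 := by
    rw [Polynomial.aeval_def, Polynomial.hom_eval₂, ← coeff_zero_eq_constantCoeff_apply,
      coeff_zero_tree]
    simp
  rw [tree_eq, mul_pow]
  have := coeff_X_pow_mul (Polynomial.aeval (tree φ) φ ^ p) p 0
  rw [zero_add] at this
  rw [this, coeff_zero_eq_constantCoeff_apply, map_pow, h0]

theorem coeff_tree_pow_of_lt (φ : Polynomial S) {p L : ℕ} (h : L < p) :
    coeff L (tree φ ^ p) = 0 :=
  X_pow_dvd_iff.1 (pow_dvd_pow_of_dvd (X_dvd_tree φ) p) L h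

/-- Lagrange inversion for the powers of `A`. -/
theorem natCast_mul_coeff_tree_pow [IsDomain S] [CharZero S] (φ : Polynomial S) (d : ℕ) :
    ∀ p : ℕ, ((p + d : ℕ) : S) * coeff (p + d) (tree φ ^ p) = p * (φ ^ (p + d)).coeff d := by
  induction d using Nat.strong_induction_on with
  | _ d ih =>
    intro p
    rcases Nat.eq_zero_or_pos d with rfl | hd
    · rw [add_zero, coeff_tree_pow_self, Polynomial.coeff_zero_eq_eval_zero,
        Polynomial.coeff_zero_eq_eval_zero, Polynomial.eval_pow]
    rcases Nat.eq_zero_or_pos p with rfl | hp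
    · simp [coeff_one, hd.ne']
    -- Since `A^p = z^p φ(A)^p`, only coefficients of degree `d` of the powers `A^k` remain; for `0
    -- < k ≤ d` they are known by induction at `d - k < d`.
    have h1 : coeff (p + d) (tree φ ^ p) =
        (φ ^ p).sum fun k r => r * coeff d (tree φ ^ k) := by
      conv_lhs => rw [tree_eq, mul_pow, ← map_pow, add_comm p d, coeff_X_pow_mul]
      rw [Polynomial.aeval_eq_sum_range, map_sum, Polynomial.sum_over_range _ (by simp)]
      exact Finset.sum_congr rfl fun k _ => by rw [coeff_smul, smul_eq_mul]
    have h2 : ∀ k, (d : S) * coeff d (tree φ ^ k) =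
        if k ≤ d then k * (φ ^ d).coeff (d - k) else 0 := by
      intro k
      split_ifs with hk
      · rcases Nat.eq_zero_or_pos k with rfl | hk0
        · simp [coeff_one, hd.ne']
        · have := ih (d - k) (by omega) k
          rwa [Nat.add_sub_cancel' hk] at this
      · rw [coeff_tree_pow_of_lt φ (not_le.1 hk), mul_zero]
    -- The factor `k` supplied by the induction hypothesis turns `φ^p` into `x (φ^p)'`.
    have h3 : (d : S) * coeff (p + d) (tree φ ^ p) =
        (Polynomial.X * (φ ^ p).derivative * φ ^ d).coeff d := by
      rw [h1, Polynomial.sum_def, Finset.mul_sum, Polynomial.coeff_mul,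
        Finset.Nat.sum_antidiagonal_eq_sum_range_succ_mk]
      have h4 : ∀ k ∈ Finset.range d.succ,
          (Polynomial.X * (φ ^ p).derivative).coeff k * (φ ^ d).coeff (d - k) =
          (φ ^ p).coeff k * ((d : S) * coeff d (tree φ ^ k)) := by
        intro k hk
        rw [h2, if_pos (Nat.lt_succ_iff.1 (Finset.mem_range.1 hk))]
        rcases k with _ | k
        · simp
        · rw [Polynomial.coeff_X_mul, Polynomial.coeff_derivative]
          push_cast
          ring
      rw [Finset.sum_congr rfl h4]
      have h5 : ∀ k, (d : S) * ((φ ^ p).coeff k * coeff d (tree φ ^ k)) =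
          (φ ^ p).coeff k * ((d : S) * coeff d (tree φ ^ k)) := fun k => by ring
      simp only [h5]
      refine Finset.sum_congr_of_eq_on_inter ?_ ?_ ?_
      · intro k _ hk
        rw [h2, if_neg (by simpa using hk), mul_zero]
      · intro k _ hk
        rw [Polynomial.notMem_support_iff.1 hk, zero_mul]
      · intros; rfl
    -- Both `(p + d) (φ^p)' φ^d` and `p (φ^(p+d))'` equal `p (p + d) φ^(p+d-1) φ'`.
    have h6 : ((p + d : ℕ) : S) * (Polynomial.X * (φ ^ p).derivative * φ ^ d).coeff d =
        p * (d * (φ ^ (p + d)).coeff d) := by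
      have h7 : Polynomial.C ((p + d : ℕ) : S) * (Polynomial.X * (φ ^ p).derivative * φ ^ d) =
          Polynomial.C (p : S) * (Polynomial.X * (φ ^ (p + d)).derivative) := by
        obtain ⟨q, rfl⟩ : ∃ q, p = q + 1 := ⟨p - 1, by omega⟩
        rw [Polynomial.derivative_pow, Polynomial.derivative_pow,
          show q + 1 + d - 1 = q + d by omega, Nat.add_sub_cancel]
        ring
      rw [← Polynomial.coeff_C_mul, h7, Polynomial.coeff_C_mul]
      obtain ⟨e, rfl⟩ : ∃ e, d = e + 1 := ⟨d - 1, by omega⟩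
      rw [Polynomial.coeff_X_mul, Polynomial.coeff_derivative]
      push_cast
      ring
    have hd0 : (d : S) ≠ 0 := Nat.cast_ne_zero.2 hd.ne'
    refine mul_left_cancel₀ hd0 ?_
    rw [mul_left_comm, h3, h6]
    ring

/-- Differentiating `A = z φ(A)` gives `(1 - z φ'(A)) z A' = A`, and `N` is the inverse of `1 - z
φ'(A)`. -/
theorem tree_mul_markedTree (φ : Polynomial S) :
    tree φ * markedTree φ = X * d⁄dX S (tree φ) := by
  set A := tree φ with hA
  set D := Polynomial.aeval A φ.derivative with hD
  have h1 : X * d⁄dX S A = A + X * D * (X * d⁄dX S A) := by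
    conv_lhs => rw [hA, tree_eq, Derivation.leibniz, Derivation.map_aeval]
    simp only [smul_eq_mul, derivative_X, mul_one, mul_add, ← hA, ← hD]
    have h := tree_eq φ
    rw [← hA] at h
    linear_combination -h
  have h2 := markedTree_eq φ
  rw [← hA, ← hD] at h2
  linear_combination (X * d⁄dX S A) * h2 - markedTree φ * h1

/-- From `A N = z A'` one gets `p N A^p = z (A^p)'`, which reduces the claim to the powers of `A`.
The division by `p` excludes `p = 0`, which needs its own induction. -/
theorem coeff_markedTree_mul_tree_pow [IsDomain S] [CharZero S] (φ : Polynomial S) {p : ℕ}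
    (hp : 0 < p) (d : ℕ) :
    coeff (p + d) (markedTree φ * tree φ ^ p) = (φ ^ (p + d)).coeff d := by
  obtain ⟨q, rfl⟩ : ∃ q, p = q + 1 := ⟨p - 1, by omega⟩
  have h1 : C ((q + 1 : ℕ) : S) * (markedTree φ * tree φ ^ (q + 1)) =
      X * d⁄dX S (tree φ ^ (q + 1)) := by
    rw [Derivation.leibniz_pow, Nat.add_sub_cancel, nsmul_eq_mul, smul_eq_mul, pow_succ,
      map_natCast]
    linear_combination ((q + 1 : ℕ) : S⟦X⟧) * tree φ ^ q * tree_mul_markedTree φ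
  have h2 := congrArg (coeff (q + 1 + d)) h1
  rw [coeff_C_mul, show q + 1 + d = q + d + 1 by omega, coeff_succ_X_mul, coeff_derivative,
    show q + d + 1 = q + 1 + d by omega, mul_comm (coeff _ _)] at h2
  have h3 := natCast_mul_coeff_tree_pow φ d (q + 1)
  refine mul_left_cancel₀ (Nat.cast_ne_zero.2 hp.ne' : ((q + 1 : ℕ) : S) ≠ 0) ?_
  rw [h2, ← h3]
  push_cast
  ring

/-- Lagrange inversion for `N`. -/
theorem coeff_markedTree [IsDomain S] [CharZero S] (φ : Polynomial S) (n : ℕ) :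
    coeff n (markedTree φ) = (φ ^ n).coeff n := by
  induction n with
  | zero => rw [markedTree_eq]; simp
  | succ n ih =>
    -- The terms of `φ'(A) N` are multiples of `A^k N`; the term `k = 0` is the induction
    -- hypothesis.
    have h1 : ∀ k, coeff n (tree φ ^ k * markedTree φ) =
        if k ≤ n then (φ ^ n).coeff (n - k) else 0 := by
      intro k
      rw [mul_comm]
      split_ifs with hk
      · rcases Nat.eq_zero_or_pos k with rfl | hk0
        · simpa using ih
        · have := coeff_markedTree_mul_tree_pow φ hk0 (n - k)
          rwa [Nat.add_sub_cancel' hk] at this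
      · exact X_pow_dvd_iff.1 ((pow_dvd_pow_of_dvd (X_dvd_tree φ) k).mul_left _) n (not_le.1 hk)
    have h2 : coeff (n + 1) (markedTree φ) = (φ.derivative * φ ^ n).coeff n := by
      rw [markedTree_eq, map_add, coeff_X_mul_aeval_mul, Polynomial.sum_def, Polynomial.coeff_mul,
        Finset.Nat.sum_antidiagonal_eq_sum_range_succ_mk, coeff_one, if_neg (Nat.succ_ne_zero n),
        zero_add]
      refine Finset.sum_congr_of_eq_on_inter ?_ ?_ ?_
      · intro k _ hk
        rw [h1, if_neg (by simpa using hk), mul_zero]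
      · intro k _ hk
        rw [Polynomial.notMem_support_iff.1 hk, zero_mul]
      · intro k _ hk
        rw [h1, if_pos (Nat.lt_succ_iff.1 (Finset.mem_range.1 hk))]
    have h3 : Polynomial.C ((n + 1 : ℕ) : S) * (φ.derivative * φ ^ n) =
        (φ ^ (n + 1)).derivative := by
      rw [Polynomial.derivative_pow, Nat.add_sub_cancel]
      ring
    have h4 := congrArg (Polynomial.coeff · n) h3
    simp only [Polynomial.coeff_C_mul, Polynomial.coeff_derivative] at h4
    refine mul_left_cancel₀ (Nat.cast_ne_zero.2 n.succ_ne_zero : ((n + 1 : ℕ) : S) ≠ 0) ?_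
    rw [h2, h4]
    push_cast
    ring

end Lagrange

end FussB

/-! ### Jucys–Murphy factorization of the length generating element. -/

namespace FussB

variable {n : ℕ} {S : Type*} [CommRing S]

/-! ### The graded group algebra -/

/-- The coefficient in degree `k` of the coefficient of `c`. -/
noncomputable def gradedCoeff (f : MonoidAlgebra (Polynomial S) (B n)) (c : B n) (k : ℕ) : S :=
  (f.coeff c).coeff k

@[simp] theorem gradedCoeff_add (f g : MonoidAlgebra (Polynomial S) (B n)) (c : B n) (k : ℕ) :
    gradedCoeff (f + g) c k = gradedCoeff f c k + gradedCoeff g c k := by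
  simp [gradedCoeff]

@[simp] theorem gradedCoeff_smul (r : S) (f : MonoidAlgebra (Polynomial S) (B n)) (c : B n)
    (k : ℕ) : gradedCoeff (r • f) c k = r * gradedCoeff f c k := by
  simp [gradedCoeff]

@[simp] theorem gradedCoeff_zero (c : B n) (k : ℕ) :
    gradedCoeff (0 : MonoidAlgebra (Polynomial S) (B n)) c k = 0 := by
  simp [gradedCoeff]

theorem gradedCoeff_sum {ι : Type*} (s : Finset ι)
    (f : ι → MonoidAlgebra (Polynomial S) (B n)) (c : B n) (k : ℕ) :
    gradedCoeff (∑ i ∈ s, f i) c k = ∑ i ∈ s, gradedCoeff (f i) c k := by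
  classical
  induction s using Finset.induction_on with
  | empty => simp
  | insert a s ha ih => rw [Finset.sum_insert ha, Finset.sum_insert ha, gradedCoeff_add, ih]

theorem gradedCoeff_one (c : B n) (k : ℕ) :
    gradedCoeff (1 : MonoidAlgebra (Polynomial S) (B n)) c k = if c = 1 ∧ k = 0 then 1 else 0 := by
  classical
  rw [gradedCoeff, MonoidAlgebra.one_def, MonoidAlgebra.coeff_single,
    Finsupp.single_apply]
  by_cases h : 1 = c
  · simp [h.symm, Polynomial.coeff_one]
  · rw [if_neg h, if_neg (fun h2 => h h2.1.symm), Polynomial.coeff_zero]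

theorem gradedCoeff_mul_aeval (f g : MonoidAlgebra (Polynomial S) (B n)) (φ : Polynomial S)
    (c : B n) (k : ℕ) : gradedCoeff (f * Polynomial.aeval g φ) c k =
      φ.sum fun p r => r * gradedCoeff (f * g ^ p) c k := by
  rw [Polynomial.aeval_eq_sum_range, Finset.mul_sum, gradedCoeff_sum,
    Polynomial.sum_over_range _ (by simp)]
  exact Finset.sum_congr rfl fun p _ => by rw [mul_smul_comm, gradedCoeff_smul]

theorem mul_pow_mem {R A : Type*} [CommRing R] [Ring A] [Algebra R A] (M : Submodule R A) {g : A}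
    (hg : ∀ f ∈ M, f * g ∈ M) {f : A} (hf : f ∈ M) (p : ℕ) : f * g ^ p ∈ M := by
  induction p with
  | zero => simpa
  | succ p ih => rw [pow_succ, ← mul_assoc]; exact hg _ ih

theorem mul_aeval_mem {R A : Type*} [CommRing R] [Ring A] [Algebra R A] (M : Submodule R A) {g : A}
    (hg : ∀ f ∈ M, f * g ∈ M) {f : A} (hf : f ∈ M) (φ : Polynomial R) :
    f * Polynomial.aeval g φ ∈ M := by
  rw [Polynomial.aeval_eq_sum_range, Finset.mul_sum]
  refine M.sum_mem fun p _ => ?_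
  rw [mul_smul_comm]
  exact M.smul_mem _ (mul_pow_mem M hg hf p)

theorem commute_aeval_right {R A : Type*} [CommRing R] [Ring A] [Algebra R A] {f g : A}
    (h : Commute f g) (φ : Polynomial R) : Commute f (Polynomial.aeval g φ) := by
  rw [Polynomial.aeval_eq_sum_range]
  exact Commute.sum_right _ _ _ fun p _ => (h.pow_right p).smul_right _

theorem prod_map_mul_of_commute {ι M : Type*} [Monoid M] (f g : ι → M)
    (h : ∀ i j, Commute (f i) (g j)) (l : List ι) :
    (l.map fun i => f i * g i).prod = (l.map f).prod * (l.map g).prod := by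
  induction l with
  | nil => simp
  | cons i l ih =>
    have : Commute (l.map f).prod (g i) :=
      Commute.list_prod_left _ _ (by simpa using fun j _ => h j i)
    simp only [List.map_cons, List.prod_cons, ih]
    rw [mul_assoc, mul_assoc, ← mul_assoc (g i), ← this.eq, mul_assoc]

noncomputable instance : Fintype (B n) := Fintype.ofFinite _

/-! ### The generating element of the absolute length -/

open scoped Classical in
variable (n) in
/-- The sum of the signed permutations fixing the indices from `j` on, weighted by their absolute
length. -/
noncomputable def lengthGen (t : S) (j : ℕ) : MonoidAlgebra (Polynomial S) (B n) :=
  ∑ w : B n with Fixes j w, MonoidAlgebra.single w ((Polynomial.C t * Polynomial.X) ^ codim w)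

theorem lengthGen_zero (t : S) : lengthGen n t 0 = 1 := by
  simp [lengthGen, fixes_zero_iff, Finset.filter_eq', MonoidAlgebra.one_def]

/-! ### Jucys–Murphy elements -/

variable [NeZero n]

/-- The positive signed index with absolute value `j` (counted from `0`). -/
def pt (n : ℕ) [NeZero n] (j : ℕ) : Fin n × ℤˣ := (Fin.ofNat n j, 1)

theorem pt_fst {j : ℕ} (hj : j < n) : ((pt n j).1 : ℕ) = j := Nat.mod_eq_of_lt hj

@[simp] theorem pt_snd (j : ℕ) : (pt n j).2 = 1 := rfl

theorem mk_eq_pt {j : ℕ} (hj : j < n) : ((⟨j, hj⟩, 1) : Fin n × ℤˣ) = pt n j :=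
  Prod.ext (Fin.ext (pt_fst hj).symm) rfl

open scoped Classical in
/-- The signed indices of absolute value at most `j`, other than `j`. -/
noncomputable def lower (n : ℕ) [NeZero n] (j : ℕ) : Finset (Fin n × ℤˣ) :=
  {a | (a.1 : ℕ) ≤ j ∧ a ≠ pt n j}

theorem mem_lower {j : ℕ} {a : Fin n × ℤˣ} : a ∈ lower n j ↔ (a.1 : ℕ) ≤ j ∧ a ≠ pt n j := by
  simp [lower]

variable (n S) in
/-- The Jucys–Murphy element: the sum of the reflections of the `j`-th signed permutation group
that are not in the previous one, weighted by the grading variable. -/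
noncomputable def jm (j : ℕ) : MonoidAlgebra (Polynomial S) (B n) :=
  ∑ a ∈ lower n j, MonoidAlgebra.single (refl a (pt n j)) Polynomial.X

theorem gradedCoeff_mul_jm_zero (f : MonoidAlgebra (Polynomial S) (B n)) (j : ℕ) (c : B n) :
    gradedCoeff (f * jm n S j) c 0 = 0 := by
  rw [jm, Finset.mul_sum, gradedCoeff_sum]
  refine Finset.sum_eq_zero fun a _ => ?_
  rw [gradedCoeff, MonoidAlgebra.coeff_mul_single_apply, Polynomial.coeff_mul_X_zero]

theorem gradedCoeff_mul_jm_succ (f : MonoidAlgebra (Polynomial S) (B n)) (j : ℕ) (c : B n)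
    (k : ℕ) : gradedCoeff (f * jm n S j) c (k + 1) =
      ∑ a ∈ lower n j, gradedCoeff f (c * refl a (pt n j)) k := by
  rw [jm, Finset.mul_sum, gradedCoeff_sum]
  refine Finset.sum_congr rfl fun a _ => ?_
  rw [gradedCoeff, MonoidAlgebra.coeff_mul_single_apply, Polynomial.coeff_mul_X, refl_inv,
    gradedCoeff]

variable (n S) in
/-- The elements in which every `c` appears in degrees at least its absolute length. -/
def lengthGraded : Submodule S (MonoidAlgebra (Polynomial S) (B n)) where
  carrier := {f | ∀ c k, k < codim c → gradedCoeff f c k = 0}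
  zero_mem' := by simp
  add_mem' hf hg := fun c k h => by rw [gradedCoeff_add, hf c k h, hg c k h, add_zero]
  smul_mem' r f hf := fun c k h => by rw [gradedCoeff_smul, hf c k h, mul_zero]

/-- A reflection raises the degree by one and the length by at most one. -/
theorem mul_jm_mem_lengthGraded (j : ℕ) :
    ∀ f ∈ lengthGraded n S, f * jm n S j ∈ lengthGraded n S := by
  rintro f hf c (_ | k) hk
  · exact gradedCoeff_mul_jm_zero f j c
  · rw [gradedCoeff_mul_jm_succ]
    refine Finset.sum_eq_zero fun a _ => hf _ _ ?_
    have := codim_le_mul_refl c a (pt n j)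
    omega

variable (n S) in
/-- The elements supported on the signed permutations that fix the indices from `j` on. -/
def supportedBelow (j : ℕ) : Submodule S (MonoidAlgebra (Polynomial S) (B n)) where
  carrier := {f | ∀ c k, ¬ Fixes j c → gradedCoeff f c k = 0}
  zero_mem' := by simp
  add_mem' hf hg := fun c k h => by rw [gradedCoeff_add, hf c k h, hg c k h, add_zero]
  smul_mem' r f hf := fun c k h => by rw [gradedCoeff_smul, hf c k h, mul_zero]

theorem mul_jm_mem_supportedBelow {i j : ℕ} (hij : i < j) (hj : j ≤ n) :
    ∀ f ∈ supportedBelow n S j, f * jm n S i ∈ supportedBelow n S j := by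
  rintro f hf c (_ | k) hk
  · exact gradedCoeff_mul_jm_zero f i c
  · rw [gradedCoeff_mul_jm_succ]
    refine Finset.sum_eq_zero fun a ha => hf _ _ fun h => hk ?_
    have h2 : Fixes j (refl a (pt n i)) :=
      fixes_refl ((mem_lower.1 ha).1.trans_lt hij) (by rwa [pt_fst (hij.trans_le hj)])
    have h3 := h.mul h2
    rwa [mul_assoc, refl_mul_self, mul_one] at h3

variable (n) in
/-- The product of the values of `φ` at the first `j` Jucys–Murphy elements. -/
noncomputable def jmProd (φ : Polynomial S) : ℕ → MonoidAlgebra (Polynomial S) (B n)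
  | 0 => 1
  | j + 1 => jmProd φ j * Polynomial.aeval (jm n S j) φ

theorem jmProd_mem_lengthGraded (φ : Polynomial S) (j : ℕ) : jmProd n φ j ∈ lengthGraded n S := by
  induction j with
  | zero =>
    intro c k hk
    rw [jmProd, gradedCoeff_one, if_neg]
    rintro ⟨rfl, rfl⟩
    simp at hk
  | succ j ih => exact mul_aeval_mem _ (mul_jm_mem_lengthGraded j) ih φ

theorem jmProd_mem_supportedBelow (φ : Polynomial S) {j m : ℕ} (hj : j ≤ m) (hm : m ≤ n) :
    jmProd n φ j ∈ supportedBelow n S m := by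
  induction j with
  | zero =>
    intro c k hc
    rw [jmProd, gradedCoeff_one, if_neg]
    rintro ⟨rfl, rfl⟩
    exact hc (fixes_one m)
  | succ j ih =>
    exact mul_aeval_mem _ (mul_jm_mem_supportedBelow (Nat.lt_of_succ_le hj) hm)
      (ih (Nat.le_of_succ_le hj)) φ

/-- Coset decomposition: `w` is uniquely `u * refl a (pt n j)` with `u` fixing the indices from `j`
on and `a = w⁻¹ (pt n j)`. The length grows by one unless `a = pt n j`, which accounts for the
summand `1`. -/
theorem lengthGen_succ (t : S) {j : ℕ} (hj : j < n) :
    lengthGen n t (j + 1) =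
      lengthGen n t j * Polynomial.aeval (jm n S j) (1 + Polynomial.C t * Polynomial.X) := by
  classical
  set x : Polynomial S := Polynomial.C t * Polynomial.X with hx
  have hpt := pt_fst (n := n) hj
  have h1 : Polynomial.aeval (jm n S j) (1 + x) =
      ∑ a ∈ insert (pt n j) (lower n j),
        MonoidAlgebra.single (refl a (pt n j)) (if a = pt n j then 1 else x) := by
    rw [Finset.sum_insert (by simp [mem_lower]), if_pos rfl, refl_self, map_add, map_one,
      MonoidAlgebra.one_def]
    congr 1
    rw [hx, map_mul, Polynomial.aeval_C, Polynomial.aeval_X, ← Algebra.smul_def, jm,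
      Finset.smul_sum]
    refine Finset.sum_congr rfl fun a ha => ?_
    rw [if_neg (mem_lower.1 ha).2, MonoidAlgebra.smul_single, Polynomial.smul_eq_C_mul]
  have hins : ∀ a, a ∈ insert (pt n j) (lower n j) ↔ (a.1 : ℕ) < j + 1 := by
    intro a
    rw [Finset.mem_insert, mem_lower]
    by_cases h : a = pt n j
    · subst h; simp [hpt]
    · simp [h]
  rw [h1, lengthGen, lengthGen, Finset.sum_mul_sum, ← Finset.sum_product']
  symm
  refine Finset.sum_bij' (fun p _ => p.1 * refl p.2 (pt n j))
    (fun w _ => (w * refl ((w⁻¹).1 (pt n j)) (pt n j), (w⁻¹).1 (pt n j))) ?_ ?_ ?_ ?_ ?_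
  · rintro ⟨w, a⟩ h
    rw [Finset.mem_product, Finset.mem_filter, hins] at h
    rw [Finset.mem_filter]
    exact ⟨Finset.mem_univ _, (h.1.2.mono (Nat.le_succ j)).mul (fixes_refl h.2 (by omega))⟩
  · intro w hw
    rw [Finset.mem_filter] at hw
    have ha : (((w⁻¹).1 (pt n j)).1 : ℕ) < j + 1 := hw.2.inv.lt (by omega)
    rw [Finset.mem_product, Finset.mem_filter, hins]
    refine ⟨⟨Finset.mem_univ _, ?_⟩, ha⟩
    refine fixes_of_succ (hw.2.mul (fixes_refl ha (by omega))) (pt n j) hpt ?_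
    rw [coe_mul_apply, refl_right, coe_coe_inv]
  · rintro ⟨w, a⟩ h
    rw [Finset.mem_product, Finset.mem_filter] at h
    have hw : (w⁻¹).1 (pt n j) = pt n j := h.1.2.inv _ (by omega)
    have h3 : ((w * refl a (pt n j))⁻¹).1 (pt n j) = a := by
      rw [mul_inv_rev, refl_inv, coe_mul_apply, hw, refl_right]
    simp only [h3]
    rw [mul_assoc, refl_mul_self, mul_one]
  · intro w _
    simp only
    rw [mul_assoc, refl_mul_self, mul_one]
  · rintro ⟨w, a⟩ h
    rw [Finset.mem_product, Finset.mem_filter, hins] at h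
    simp only [MonoidAlgebra.single_mul_single]
    split_ifs with ha
    · obtain rfl : a = pt n j := ha
      rw [refl_self, mul_one, mul_one]
    · rw [h.1.2.codim_mul_refl hpt
        (Nat.lt_succ_iff.1 h.2) ha, pow_succ]

/-- Conjugation by `w` fixes `pt n j` and permutes `lower n j`, hence permutes the summands of `jm n
S j`. -/
theorem single_commute_jm {j : ℕ} (hj : j < n) {w : B n} (hw : Fixes j w) (r : Polynomial S) :
    Commute (MonoidAlgebra.single w r) (jm n S j) := by
  have hpt := pt_fst (n := n) hj
  rw [Commute, SemiconjBy, jm, Finset.mul_sum, Finset.sum_mul]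
  simp only [MonoidAlgebra.single_mul_single]
  refine Finset.sum_bij' (fun a _ => w.1 a) (fun a _ => (w⁻¹).1 a) ?_ ?_ (by simp) (by simp) ?_
  · intro a ha
    rw [mem_lower] at ha ⊢
    refine ⟨Nat.lt_succ_iff.1 ((hw.mono (Nat.le_succ j)).lt (Nat.lt_succ_iff.2 ha.1)), ?_⟩
    rw [← hw (pt n j) hpt.ge]
    exact fun h => ha.2 (w.1.injective h)
  · intro a ha
    rw [mem_lower] at ha ⊢
    refine ⟨Nat.lt_succ_iff.1 ((hw.inv.mono (Nat.le_succ j)).lt (Nat.lt_succ_iff.2 ha.1)), ?_⟩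
    rw [← hw.inv (pt n j) hpt.ge]
    exact fun h => ha.2 ((w⁻¹).1.injective h)
  · intro a _
    rw [mul_refl, hw (pt n j) hpt.ge, mul_comm r]

theorem lengthGen_commute_jm (t : S) {j : ℕ} (hj : j < n) :
    Commute (lengthGen n t j) (jm n S j) := by
  classical
  exact Commute.sum_left _ _ _ fun w hw => single_commute_jm hj (Finset.mem_filter.1 hw).2 _

/-- At each level the factors `1 + t J_j` commute with all elements of the lower level, so they can
be collected on the right into one polynomial in `J_j`. -/
theorem prod_map_lengthGen (ts : List S) {j : ℕ} (hj : j ≤ n) :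
    (ts.map fun t => lengthGen n t j).prod =
      jmProd n (ts.map fun t => 1 + Polynomial.C t * Polynomial.X).prod j := by
  induction j with
  | zero => simp [lengthGen_zero, jmProd]
  | succ j ih =>
    have hj' : j < n := hj
    simp only [lengthGen_succ _ hj']
    rw [prod_map_mul_of_commute, ih hj'.le, jmProd, map_list_prod, List.map_map]
    · rfl
    · exact fun t u => commute_aeval_right (lengthGen_commute_jm t hj') _

end FussB

/-! ### Lowest-degree coefficients at products of interval cycles. -/

namespace FussB

variable {n : ℕ} [NeZero n]

theorem pt_inj {i j : ℕ} (hi : i < n) (hj : j < n) : pt n i = pt n j ↔ i = j :=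
  ⟨fun h => by rw [← pt_fst hi, ← pt_fst hj, h], fun h => by rw [h]⟩

theorem eq_pt_or_eq_bar_pt (a : Fin n × ℤˣ) : a = pt n a.1 ∨ a = bar (pt n a.1) :=
  eq_or_eq_bar_of_fst_eq (Fin.ext (pt_fst a.1.2).symm)

theorem indicator_pt (s t : ℕ) {j : ℕ} (hj : j < n) :
    indicator s t (pt n j) = if s ≤ j ∧ j < t then 1 else 0 := by
  rw [indicator, pt_fst hj]
  simp

/-! ### Cycles on intervals -/

variable (n) in
/-- The sign change at the index `j`. -/
def sgn (j : ℕ) : B n := refl (bar (pt n j)) (pt n j)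

variable (n) in
/-- The cycle `s → s + 1 → ⋯ → s + L → s` and its opposite. -/
def cyc (s : ℕ) : ℕ → B n
  | 0 => 1
  | L + 1 => cyc s L * refl (pt n (s + L)) (pt n (s + L + 1))

theorem cyc_add (s a b : ℕ) : cyc n s (a + b) = cyc n s a * cyc n (s + a) b := by
  induction b with
  | zero => simp [cyc]
  | succ b ih => rw [← add_assoc, cyc, cyc, ih, mul_assoc, add_assoc s a b]

theorem fixes_cyc {s L : ℕ} (h : s + L < n) : Fixes (s + L + 1) (cyc n s L) := by
  induction L with
  | zero => exact fixes_one _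
  | succ L ih =>
    exact ((ih (by omega)).mono (by omega)).mul
      (fixes_refl (by rw [pt_fst (by omega)]; omega) (by rw [pt_fst (by omega)]; omega))

theorem cyc_apply_of_lt {s L : ℕ} (h : s + L < n) {x : Fin n × ℤˣ} (hx : (x.1 : ℕ) < s) :
    (cyc n s L).1 x = x := by
  induction L with
  | zero => rfl
  | succ L ih =>
    rw [cyc, coe_mul_apply, refl_of_ne, ih (by omega)]
    · intro h2
      rw [h2, pt_fst (by omega)] at hx
      omega
    · intro h2
      rw [h2, pt_fst (by omega)] at hx
      omega

theorem cyc_apply_last (s L : ℕ) : (cyc n s L).1 (pt n (s + L)) = pt n s := by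
  induction L with
  | zero => rfl
  | succ L ih => rw [cyc, coe_mul_apply, ← add_assoc, refl_right, ih]

/-- A transposition of two points of a cycle cuts it in two; the piece containing the last index is
again an interval cycle, so the cutting can be iterated. -/
theorem cyc_mul_refl {s q m : ℕ} (h : s + (q + 1 + m) < n) :
    cyc n s (q + 1 + m) * refl (pt n (s + q)) (pt n (s + (q + 1 + m))) =
      cyc n s q * cyc n (s + q + 1) m := by
  have h1 : (cyc n (s + q + 1) m).1 (pt n (s + q)) = pt n (s + q) :=
    cyc_apply_of_lt (by omega) (by rw [pt_fst (by omega)]; omega)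
  have h2 : (cyc n (s + q + 1) m).1 (pt n (s + (q + 1 + m))) = pt n (s + q + 1) := by
    rw [← cyc_apply_last (s + q + 1) m, show s + (q + 1 + m) = s + q + 1 + m by omega]
  rw [cyc_add, cyc, mul_assoc, ← add_assoc, mul_refl (cyc n (s + q + 1) m), ← add_assoc s (q + 1) m,
    ← add_assoc s q 1]
  rw [show s + (q + 1 + m) = s + q + 1 + m by omega] at h2
  rw [h1, h2, ← mul_assoc, mul_assoc (cyc n s q), refl_mul_self, mul_one]

theorem sgn_apply_self (j : ℕ) : (sgn n j).1 (pt n j) = bar (pt n j) := refl_right _ _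

theorem sgn_apply_of_ne {j : ℕ} {x : Fin n × ℤˣ} (h : x.1 ≠ (pt n j).1) : (sgn n j).1 x = x :=
  refl_of_ne h h

/-- Cutting a negative cycle at an opposite point leaves the sign with the piece containing the last
index. -/
theorem cyc_mul_sgn_mul_refl_bar {s q m : ℕ} (h : s + (q + 1 + m) < n) :
    cyc n s (q + 1 + m) * sgn n (s + (q + 1 + m)) *
        refl (bar (pt n (s + q))) (pt n (s + (q + 1 + m))) =
      cyc n s q * cyc n (s + q + 1) m * sgn n (s + (q + 1 + m)) := by
  have h1 : (pt n (s + q)).1 ≠ (pt n (s + (q + 1 + m))).1 := by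
    rw [Ne, Fin.ext_iff, pt_fst (by omega), pt_fst h]
    omega
  rw [mul_assoc, mul_refl, coe_bar, sgn_apply_of_ne h1, sgn_apply_self, refl_bar_bar, ← mul_assoc,
    cyc_mul_refl h]

/-- Cutting at a positive point instead moves the sign to the first piece. -/
theorem cyc_mul_sgn_mul_refl {s q m : ℕ} (h : s + (q + 1 + m) < n) :
    cyc n s (q + 1 + m) * sgn n (s + (q + 1 + m)) * refl (pt n (s + q)) (pt n (s + (q + 1 + m))) =
      cyc n s q * sgn n (s + q) * cyc n (s + q + 1) m := by
  have h1 : sgn n (s + (q + 1 + m)) * refl (pt n (s + q)) (pt n (s + (q + 1 + m))) =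
      refl (pt n (s + q)) (pt n (s + (q + 1 + m))) * sgn n (s + q) := by
    have := mul_refl (refl (pt n (s + q)) (pt n (s + (q + 1 + m)))) (bar (pt n (s + q)))
      (pt n (s + q))
    rw [coe_bar, refl_left] at this
    exact this.symm
  have h2 : (cyc n (s + q + 1) m).1 (pt n (s + q)) = pt n (s + q) :=
    cyc_apply_of_lt (by omega) (by rw [pt_fst (by omega)]; omega)
  rw [mul_assoc, h1, ← mul_assoc, cyc_mul_refl h, sgn, mul_assoc, mul_refl, coe_bar, h2, mul_assoc]

theorem mem_invariants_cyc {s L : ℕ} {f : Fin n × ℤˣ → ℚ} (hf : ∀ x, f (bar x) = -f x) {v : ℚ}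
    (h : ∀ x, s ≤ x → x ≤ s + L → f (pt n x) = v) : f ∈ invariants (cyc n s L) := by
  induction L with
  | zero => exact ⟨hf, fun _ => rfl⟩
  | succ L ih =>
    refine mul_mem_invariants (ih fun x h1 h2 => h x h1 (by omega)) ⟨hf, fun x => ?_⟩
    refine odd_apply_refl hf ?_ x
    rw [h _ (by omega) (by omega), h _ (by omega) (by omega)]

theorem mem_invariants_block {s L : ℕ} (h : s + L < n) {u : B n} (hu : Fixes s u) :
    indicator s (s + L + 1) ∈ invariants (u * cyc n s L) :=
  mul_mem_invariants hu.indicator_mem <| mem_invariants_cyc (indicator_bar _ _) (v := 1)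
    fun x h1 h2 => by rw [indicator_pt _ _ (by omega), if_pos (by omega)]

theorem codim_mul_cyc {s L : ℕ} (h : s + L < n) {u : B n} (hu : Fixes s u) :
    codim (u * cyc n s L) = codim u + L := by
  induction L with
  | zero => simp [cyc]
  | succ L ih =>
    have h1 : Fixes (s + L + 1) (u * cyc n s L) := (hu.mono (by omega)).mul (fixes_cyc (by omega))
    rw [cyc, ← mul_assoc, h1.codim_mul_refl (pt_fst (by omega)) (by rw [pt_fst (by omega)]; omega),
      ih (by omega), add_assoc]
    rw [Ne, pt_inj (by omega) (by omega)]
    omega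

theorem codim_mul_cyc_mul_sgn {s L : ℕ} (h : s + L < n) {u : B n} (hu : Fixes s u) :
    codim (u * cyc n s L * sgn n (s + L)) = codim u + L + 1 := by
  rw [sgn, codim_mul_refl (mem_invariants_block h hu), codim_mul_cyc h hu]
  rw [indicator_bar, indicator_pt _ _ h, if_pos (by omega)]
  norm_num

/-! ### Products of blocks -/

variable {S : Type*} [CommRing S]

/-- Signed permutations fixing the indices from `s` on whose other cycles are supported on
intervals, at most one of them (recorded by the Boolean) being negative, together with their
absolute length and their weight. -/
inductive BlockProd (φ : Polynomial S) : ℕ → Bool → ℕ → S → B n → Prop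
  | nil : BlockProd φ 0 false 0 1 1
  | pos {s L : ℕ} {ν : Bool} {d : ℕ} {G : S} {u : B n} (hu : BlockProd φ s ν d G u)
      (h : s + L < n) :
      BlockProd φ (s + L + 1) ν (d + L) (G * PowerSeries.coeff (L + 1) (tree φ)) (u * cyc n s L)
  | neg {s L d : ℕ} {G : S} {u : B n} (hu : BlockProd φ s false d G u) (h : s + L < n) :
      BlockProd φ (s + L + 1) true (d + L + 1)
        (G * PowerSeries.coeff (L + 1) (markedTree φ)) (u * cyc n s L * sgn n (s + L))

namespace BlockProd

variable {φ : Polynomial S} {s d : ℕ} {ν : Bool} {G : S} {u : B n}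

theorem fixes (hu : BlockProd φ s ν d G u) : Fixes s u := by
  induction hu with
  | nil => exact fixes_one 0
  | pos _ h ih => exact (ih.mono (by omega)).mul (fixes_cyc h)
  | neg _ h ih =>
    refine ((ih.mono (by omega)).mul (fixes_cyc h)).mul (fixes_refl ?_ ?_) <;>
    simp [pt_fst h]

theorem codim_eq (hu : BlockProd φ s ν d G u) : codim u = d := by
  induction hu with
  | nil => exact codim_one
  | pos hu h ih => rw [codim_mul_cyc h hu.fixes, ih]
  | neg hu h ih => rw [codim_mul_cyc_mul_sgn h hu.fixes, ih]

/-- Without negative cycles, the function equal to `1` on all positive points below `s` is constant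
along each cycle. It serves to separate earlier blocks from a new negative one. -/
theorem indicator_mem (hu : BlockProd φ s ν d G u) (hν : ν = false) :
    indicator 0 s ∈ invariants u := by
  induction hu with
  | nil => exact (fixes_one 0).indicator_mem
  | @pos s L ν d G u hu h ih =>
    have h1 : (indicator 0 (s + L + 1) : Fin n × ℤˣ → ℚ) =
        indicator 0 s + indicator s (s + L + 1) := by
      ext x
      simp only [indicator, Pi.add_apply]
      split_ifs <;> first | omega | simp
    refine mul_mem_invariants ?_ (mem_invariants_cyc (indicator_bar _ _) (v := 1) ?_)
    · rw [h1]
      exact (invariants u).add_mem (ih hν) hu.fixes.indicator_mem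
    · intro x h1 h2
      rw [indicator_pt _ _ (by omega), if_pos (by omega)]
  | neg => cases hν

end BlockProd

/-- A reflection outside `T` lengthens `c`, and then degree `codim c - 1` is too low for an element
of `lengthGraded`. The condition `h0` covers the truncated subtraction at `codim c = 0`. -/
theorem gradedCoeff_mul_jm_eq_sum {f : MonoidAlgebra (Polynomial S) (B n)}
    (hf : f ∈ lengthGraded n S) {j : ℕ} {c : B n} {T : Finset (Fin n × ℤˣ)} (hT : T ⊆ lower n j)
    (h : ∀ a ∈ lower n j, a ∉ T → codim (c * refl a (pt n j)) = codim c + 1)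
    (h0 : codim c = 0 → T = ∅) :
    gradedCoeff (f * jm n S j) c (codim c) =
      ∑ a ∈ T, gradedCoeff f (c * refl a (pt n j)) (codim c - 1) := by
  obtain hk | ⟨k, hk⟩ : codim c = 0 ∨ ∃ k, codim c = k + 1 :=
    (Nat.eq_zero_or_pos _).imp id fun h => ⟨_, (Nat.succ_pred_eq_of_pos h).symm⟩
  · rw [h0 hk, hk, gradedCoeff_mul_jm_zero, Finset.sum_empty]
  · rw [hk, gradedCoeff_mul_jm_succ, Nat.add_sub_cancel]
    refine (Finset.sum_subset hT fun a ha haT => hf _ _ ?_).symm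
    rw [h a ha haT]
    omega

theorem coeff_mul_eq_sum_range (f g : PowerSeries S) (L : ℕ) :
    PowerSeries.coeff L (f * g) =
      ∑ q ∈ Finset.range L, PowerSeries.coeff (q + 1) f * PowerSeries.coeff (L - 1 - q) g +
        PowerSeries.coeff 0 f * PowerSeries.coeff L g := by
  rw [PowerSeries.coeff_mul, Finset.Nat.sum_antidiagonal_eq_sum_range_succ_mk,
    Finset.sum_range_succ']
  simp only [Nat.sub_zero]
  congr 1
  exact Finset.sum_congr rfl fun q _ => by rw [Nat.sub_sub, add_comm 1 q]

theorem jmProd_mul_pow_mem (φ : Polynomial S) (j p : ℕ) :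
    jmProd n φ j * jm n S j ^ p ∈ lengthGraded n S :=
  mul_pow_mem (lengthGraded n S) (mul_jm_mem_lengthGraded j) (jmProd_mem_lengthGraded φ j) p

/-- Each factor `J_j` cuts an initial piece off the cycle ending at `j`. The piece becomes a
finished block weighted by a coefficient of `A`, so `p` factors produce `A^p`. -/
theorem gradedCoeff_block {φ : Polynomial S} {j : ℕ} (hj : j < n)
    (IH : ∀ ν d G u, BlockProd φ j ν d G u → gradedCoeff (jmProd n φ j) u d = G) (p : ℕ) :
    ∀ {s L : ℕ} {ν : Bool} {d : ℕ} {G : S} {u : B n},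
    s + L = j → BlockProd φ s ν d G u →
    gradedCoeff (jmProd n φ j * jm n S j ^ p) (u * cyc n s L) (d + L) =
      G * PowerSeries.coeff L (tree φ ^ p) := by
  induction p with
  | zero =>
    intro s L ν d G u hL hu
    rw [pow_zero, mul_one, pow_zero, PowerSeries.coeff_one]
    rcases Nat.eq_zero_or_pos L with rfl | hL0
    · rw [cyc, mul_one, if_pos rfl, mul_one]
      obtain rfl : s = j := hL
      exact IH _ _ _ _ hu
    -- With no factor `J_j` left only elements fixing `j` occur, whereas a cycle with `L > 0` moves
    -- `j`.
    · rw [if_neg hL0.ne', mul_zero]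
      refine jmProd_mem_supportedBelow φ le_rfl hj.le _ _ fun h => ?_
      have h1 := h (pt n j) (pt_fst hj).ge
      rw [coe_mul_apply, ← hL, cyc_apply_last, hu.fixes _ (pt_fst (by omega)).ge,
        pt_inj (by omega) (by omega)] at h1
      omega
  | succ p ihp =>
    intro s L ν d G u hL hu
    have hc : codim (u * cyc n s L) = d + L := by
      rw [codim_mul_cyc (by omega) hu.fixes, hu.codim_eq]
    have hinj : Set.InjOn (fun q => pt n (s + q)) (Finset.range L) := by
      intro a ha b hb h
      rw [Finset.coe_range, Set.mem_Iio] at ha hb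
      have := (pt_inj (by omega) (by omega)).1 h
      omega
    have hsum := gradedCoeff_mul_jm_eq_sum (j := j) (c := u * cyc n s L)
      (T := (Finset.range L).image fun q => pt n (s + q))
      (jmProd_mul_pow_mem φ j p) ?_ ?_ ?_
    · rw [pow_succ, ← mul_assoc, ← hc, hsum, Finset.sum_image hinj, hc, pow_succ',
        coeff_mul_eq_sum_range, coeff_zero_tree, zero_mul, add_zero, Finset.mul_sum]
      refine Finset.sum_congr rfl fun q hq => ?_
      obtain ⟨m, rfl⟩ : ∃ m, L = q + 1 + m := ⟨L - q - 1, by have := Finset.mem_range.1 hq; omega⟩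
      have := ihp (s := s + q + 1) (L := m) (by omega) (hu.pos (L := q) (by omega))
      rw [show q + 1 + m - 1 - q = m by omega, ← mul_assoc, ← this, mul_assoc, mul_assoc, ← hL,
        cyc_mul_refl (by omega), show d + (q + 1 + m) - 1 = d + q + m by omega]
    · intro a ha
      obtain ⟨q, hq, rfl⟩ := Finset.mem_image.1 ha
      have := Finset.mem_range.1 hq
      rw [mem_lower, Ne, pt_inj (by omega) hj, pt_fst (by omega)]
      omega
    · intro a ha haT
      -- The indicator of the block is `1` at `pt n j`; on `lower n j` it equals `1` only at the
      -- positive points of the block, which form `T`.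
      refine codim_mul_refl (mem_invariants_block (by omega) hu.fixes) ?_
      rw [indicator_pt _ _ hj, if_pos (by omega)]
      rw [mem_lower] at ha
      by_cases hs : s ≤ (a.1 : ℕ)
      · rcases eq_pt_or_eq_bar_pt a with h | h
        · refine absurd (Finset.mem_image.2 ⟨a.1 - s, ?_, ?_⟩) haT
          · rw [Finset.mem_range]
            have : (a.1 : ℕ) ≠ j := fun h2 => ha.2 (h2 ▸ h)
            omega
          · rw [Nat.add_sub_cancel' hs, ← h]
        · rw [h, indicator_bar, indicator_pt _ _ a.1.2, if_pos (by omega)]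
          norm_num
      · rw [indicator, if_neg (by omega)]
        exact zero_ne_one
    · intro h0
      obtain rfl : L = 0 := by omega
      simp

/-- A factor `J_j` can cut off a negative block (weight from `N`), cut off a positive block (weight
from `A`), or remove the sign (the constant term `1` of `N`). The sum is `N A^p + A (p A^(p-1) N) =
(p + 1) A^p N`; the factor `p` makes the truncated exponent `p - 1` harmless. -/
theorem gradedCoeff_negBlock {φ : Polynomial S} {j : ℕ} (hj : j < n)
    (IH : ∀ ν d G u, BlockProd φ j ν d G u → gradedCoeff (jmProd n φ j) u d = G) (p : ℕ) :
    ∀ {s L d : ℕ} {G : S} {u : B n},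
    s + L = j → BlockProd φ s false d G u →
    gradedCoeff (jmProd n φ j * jm n S j ^ p) (u * cyc n s L * sgn n j) (d + L + 1) =
      G * (p * PowerSeries.coeff L (tree φ ^ (p - 1) * markedTree φ)) := by
  induction p with
  | zero =>
    intro s L d G u hL hu
    rw [pow_zero, mul_one, Nat.cast_zero, zero_mul, mul_zero]
    refine jmProd_mem_supportedBelow φ le_rfl hj.le _ _ fun h => ?_
    have h1 := h (pt n j) (pt_fst hj).ge
    rw [coe_mul_apply, sgn_apply_self, coe_mul_apply, coe_bar, ← hL, cyc_apply_last,
      coe_bar, hu.fixes _ (pt_fst (by omega)).ge] at h1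
    simpa using congrArg Prod.snd h1
  | succ p ihp =>
    intro s L d G u hL hu
    have hc : codim (u * cyc n s L * sgn n j) = d + L + 1 := by
      rw [← hL, codim_mul_cyc_mul_sgn (by omega) hu.fixes, hu.codim_eq]
    have hinj : Set.InjOn (fun q => pt n (s + q)) (Finset.range (L + 1)) := by
      intro a ha b hb h
      rw [Finset.coe_range, Set.mem_Iio] at ha hb
      have := (pt_inj (by omega) (by omega)).1 h
      omega
    have hinj' : Set.InjOn (fun q => pt n (s + q)) (Finset.range L) :=
      hinj.mono (by simp)
    have hinj'' : Set.InjOn (fun q => bar (pt n (s + q))) (Finset.range (L + 1)) :=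
      fun a ha b hb h => hinj ha hb (bar_inj.1 h)
    have hsum := gradedCoeff_mul_jm_eq_sum (j := j) (c := u * cyc n s L * sgn n j)
      (T := (Finset.range L).image (fun q => pt n (s + q)) ∪
        (Finset.range (L + 1)).image fun q => bar (pt n (s + q)))
      (jmProd_mul_pow_mem φ j p) ?_ ?_ ?_
    -- The last term of the second family, `q = L`, is the sign change at `j` itself; it leaves the
    -- positive cycle treated by `gradedCoeff_block`.
    · rw [Finset.sum_union, Finset.sum_image hinj', Finset.sum_image hinj'',
        Finset.sum_range_succ, hc, Nat.add_sub_cancel, hL, mul_assoc _ (sgn n j) (refl _ _), sgn,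
        refl_mul_self, mul_one, ← sgn] at hsum
      · rw [pow_succ, ← mul_assoc, hsum, gradedCoeff_block hj IH p hL hu]
        have h1 : ∀ q ∈ Finset.range L,
            gradedCoeff (jmProd n φ j * jm n S j ^ p)
              (u * cyc n s L * sgn n j * refl (pt n (s + q)) (pt n j)) (d + L) =
            G * (PowerSeries.coeff (q + 1) (markedTree φ) *
              PowerSeries.coeff (L - 1 - q) (tree φ ^ p)) := by
          intro q hq
          obtain ⟨m, rfl⟩ : ∃ m, L = q + 1 + m :=
            ⟨L - q - 1, by have := Finset.mem_range.1 hq; omega⟩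
          have := gradedCoeff_block hj IH (s := s + q + 1) (L := m) p (by omega)
            (hu.neg (L := q) (by omega))
          rw [show q + 1 + m - 1 - q = m by omega, ← mul_assoc, ← this, ← hL, mul_assoc u,
            mul_assoc u, cyc_mul_sgn_mul_refl (by omega),
            show d + (q + 1 + m) = d + q + 1 + m by omega]
          simp only [mul_assoc]
        have h2 : ∀ q ∈ Finset.range L,
            gradedCoeff (jmProd n φ j * jm n S j ^ p)
              (u * cyc n s L * sgn n j * refl (bar (pt n (s + q))) (pt n j)) (d + L) =
            G * (PowerSeries.coeff (q + 1) (tree φ) *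
              (p * PowerSeries.coeff (L - 1 - q) (tree φ ^ (p - 1) * markedTree φ))) := by
          intro q hq
          obtain ⟨m, rfl⟩ : ∃ m, L = q + 1 + m :=
            ⟨L - q - 1, by have := Finset.mem_range.1 hq; omega⟩
          have := ihp (s := s + q + 1) (L := m) (by omega) (hu.pos (L := q) (by omega))
          rw [show q + 1 + m - 1 - q = m by omega, ← mul_assoc, ← this, ← hL, mul_assoc u,
            mul_assoc u, cyc_mul_sgn_mul_refl_bar (by omega),
            show d + (q + 1 + m) = d + q + m + 1 by omega]
          simp only [mul_assoc]
        rw [Finset.sum_congr rfl h1, Finset.sum_congr rfl h2, ← Finset.mul_sum, ← Finset.mul_sum]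
        have h3 := coeff_mul_eq_sum_range (markedTree φ) (tree φ ^ p) L
        have h4 := coeff_mul_eq_sum_range (tree φ)
          ((p : PowerSeries S) * (tree φ ^ (p - 1) * markedTree φ)) L
        have h5 : PowerSeries.coeff 0 (markedTree φ) = 1 := by
          rw [markedTree_eq]
          simp
        have h6 : ∀ (k : ℕ) (f : PowerSeries S),
            PowerSeries.coeff k ((p : PowerSeries S) * f) = p * PowerSeries.coeff k f :=
          fun k f => by rw [← map_natCast (PowerSeries.C (R := S)), PowerSeries.coeff_C_mul]
        rw [h5, one_mul] at h3
        rw [coeff_zero_tree, zero_mul, add_zero, mul_left_comm, h6] at h4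
        simp only [h6] at h4
        have h7 : (p : S) * PowerSeries.coeff L (tree φ * (tree φ ^ (p - 1) * markedTree φ)) =
            p * PowerSeries.coeff L (tree φ ^ p * markedTree φ) := by
          rcases p with _ | p
          · simp
          · rw [Nat.add_sub_cancel, ← mul_assoc, ← pow_succ']
        rw [h7] at h4
        rw [← h4, Nat.add_sub_cancel, mul_comm (tree φ ^ p)]
        push_cast
        linear_combination (-G) * h3
      · rw [Finset.disjoint_left]
        intro a ha hb
        obtain ⟨q, -, rfl⟩ := Finset.mem_image.1 ha
        obtain ⟨r, -, h⟩ := Finset.mem_image.1 hb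
        simpa using congrArg Prod.snd h
    · intro a ha
      rcases Finset.mem_union.1 ha with ha | ha
      · obtain ⟨q, hq, rfl⟩ := Finset.mem_image.1 ha
        have := Finset.mem_range.1 hq
        rw [mem_lower, Ne, pt_inj (by omega) hj, pt_fst (by omega)]
        omega
      · obtain ⟨q, hq, rfl⟩ := Finset.mem_image.1 ha
        have := Finset.mem_range.1 hq
        rw [mem_lower, bar_fst, pt_fst (by omega)]
        exact ⟨by omega, fun h => by simpa using congrArg Prod.snd h⟩
    · intro a ha haT
      rw [mem_lower] at ha
      have hs : (a.1 : ℕ) < s := by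
        by_contra hs
        refine haT (Finset.mem_union.2 ?_)
        rcases eq_pt_or_eq_bar_pt a with h | h
        · refine Or.inl (Finset.mem_image.2 ⟨a.1 - s, ?_, ?_⟩)
          · rw [Finset.mem_range]
            have : (a.1 : ℕ) ≠ j := fun h2 => ha.2 (h2 ▸ h)
            omega
          · rw [Nat.add_sub_cancel' (not_lt.1 hs), ← h]
        · refine Or.inr (Finset.mem_image.2 ⟨a.1 - s, ?_, ?_⟩)
          · rw [Finset.mem_range]
            omega
          · rw [Nat.add_sub_cancel' (not_lt.1 hs), ← h]
      -- All earlier blocks are positive, so `indicator 0 s` is invariant. It vanishes on the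
      -- negative cycle but not at `a`; a second negative cycle would destroy this argument.
      have hv : ∀ x, s ≤ x → x ≤ s + L → indicator 0 s (pt n x) = 0 := fun x h1 h2 => by
        rw [indicator_pt _ _ (by omega), if_neg (by omega)]
      refine codim_mul_refl (f := indicator 0 s) (mul_mem_invariants (mul_mem_invariants
        (hu.indicator_mem rfl) (mem_invariants_cyc (indicator_bar _ _) hv)) ⟨indicator_bar _ _,
        odd_apply_refl (indicator_bar _ _) ?_⟩) ?_
      · rw [indicator_bar, hv j (by omega) hL.ge, neg_zero]
      · rw [hv j (by omega) hL.ge, indicator, if_pos (by omega)]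
        simp
    · intro h0
      omega

/-- The lowest-degree coefficient of a product of blocks in a product of values of `φ` at
Jucys–Murphy elements is its weight. -/
theorem gradedCoeff_jmProd {φ : Polynomial S} (s : ℕ) : ∀ (ν : Bool) (d : ℕ) (G : S) (u : B n),
    BlockProd φ s ν d G u → gradedCoeff (jmProd n φ s) u d = G := by
  induction s with
  | zero =>
    intro ν d G u hu
    cases hu
    rw [jmProd, gradedCoeff_one, if_pos ⟨rfl, rfl⟩]
  | succ j IH =>
    intro ν d G u hu
    rw [jmProd, gradedCoeff_mul_aeval]
    obtain ⟨i, hi⟩ : ∃ i, i = j + 1 := ⟨_, rfl⟩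
    rw [← hi] at hu
    cases hu with
    | nil => omega
    | @pos s L _ d G u hu h =>
      obtain rfl : s + L = j := by omega
      simp only [gradedCoeff_block h IH _ rfl hu]
      have := coeff_X_mul_aeval_mul φ (tree φ) 1 L
      rw [mul_one, ← tree_eq] at this
      rw [this, Polynomial.sum_def, Polynomial.sum_def, Finset.mul_sum]
      exact Finset.sum_congr rfl fun p _ => by rw [mul_one, mul_left_comm]
    | @neg s L d G u hu h =>
      obtain rfl : s + L = j := by omega
      simp only [gradedCoeff_negBlock h IH _ rfl hu]
      have h1 : PowerSeries.coeff (L + 1) (markedTree φ) =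
          φ.sum fun p r => r * (p * PowerSeries.coeff L (tree φ ^ (p - 1) * markedTree φ)) := by
        conv_lhs => rw [markedTree_eq]
        rw [map_add, mul_assoc, PowerSeries.coeff_succ_X_mul, PowerSeries.coeff_one,
          if_neg L.succ_ne_zero, zero_add, Polynomial.derivative_apply, Polynomial.sum_def,
          Polynomial.sum_def, map_sum, Finset.sum_mul, map_sum]
        refine Finset.sum_congr rfl fun p _ => ?_
        rw [map_mul (Polynomial.aeval _), Polynomial.aeval_C, map_pow, Polynomial.aeval_X,
          mul_assoc, ← Algebra.smul_def, PowerSeries.coeff_smul, smul_eq_mul, mul_assoc]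
      rw [h1, Polynomial.sum_def, Polynomial.sum_def, Finset.mul_sum]
      exact Finset.sum_congr rfl fun p _ => by rw [mul_left_comm]

variable (n) in
/-- The standard Coxeter element. -/
def stdCoxeter : B n := cyc n 0 (n - 1) * sgn n (n - 1)

/-- The standard Coxeter element is a single negative block on all indices, of weight `[z^n] N`. -/
theorem gradedCoeff_stdCoxeter [IsDomain S] [CharZero S] (φ : Polynomial S) :
    gradedCoeff (jmProd n φ n) (stdCoxeter n) n = (φ ^ n).coeff n := by
  obtain ⟨m, hm⟩ : ∃ m, n = m + 1 := ⟨n - 1, (Nat.succ_pred_eq_of_pos (NeZero.pos n)).symm⟩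
  have h := BlockProd.neg (n := n) (BlockProd.nil (φ := φ)) (L := m) (by omega)
  have h2 := gradedCoeff_jmProd _ _ _ _ _ h
  simp only [zero_add, one_mul, ← hm] at h2
  rw [coeff_markedTree, show m = n - 1 by omega] at h2
  exact h2

theorem codim_stdCoxeter : codim (stdCoxeter n) = n := by
  have hn := NeZero.pos n
  have := codim_mul_cyc_mul_sgn (n := n) (s := 0) (L := n - 1) (by omega) (fixes_one 0)
  simp only [one_mul, codim_one, zero_add] at this
  rw [stdCoxeter, this]
  omega

end FussB

namespace FussB

/-! ### Conjugacy of Coxeter elements -/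

/-- For generators along a path, all products of the first `m` generators, each taken once, are
conjugate, even after multiplication by an element commuting with the first `m - 1` generators. -/
theorem isConj_prod_of_perm_range {G : Type*} [Group G] {s : ℕ → G} {m : ℕ}
    (hs : ∀ i j, i + 1 < j → j < m → Commute (s i) (s j)) {x : G}
    (hx : ∀ i, i + 1 < m → Commute (s i) x) {U : List ℕ} (hU : U.Perm (List.range m)) :
    IsConj ((U.map s).prod * x) (((List.range m).map s).prod * x) := by
  induction m generalizing x U with
  | zero =>
    rw [List.range_zero] at hU
    rw [hU.eq_nil, List.range_zero]
  | succ m ih =>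
    obtain ⟨U₁, U₂, rfl⟩ := List.append_of_mem (hU.mem_iff.2 (List.mem_range.2 m.lt_succ_self))
    have hnd : (U₁ ++ m :: U₂).Nodup := hU.nodup_iff.2 List.nodup_range
    have hperm : (U₁ ++ U₂).Perm (List.range m) := by
      rw [List.range_succ] at hU
      have h1 := List.perm_middle.symm.trans (hU.trans (List.perm_append_singleton m _))
      exact h1.cons_inv
    have hlt : ∀ i ∈ U₁ ++ U₂, i < m := fun i hi => List.mem_range.1 (hperm.mem_iff.1 hi)
    have key : IsConj (((U₁ ++ m :: U₂).map s).prod * x)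
        (((U₁ ++ U₂).map s).prod * (s m * x)) := by
      rw [List.map_append, List.map_cons, List.prod_append, List.prod_cons, List.map_append,
        List.prod_append]
      -- Among the smaller generators only `s (m - 1)` may fail to commute with `s m`, so `s m`
      -- moves freely across the side not containing it. If it moves to the front, a conjugation
      -- brings `s m * x` to the end.
      by_cases h : m - 1 ∈ U₂
      · have h1 : Commute (U₁.map s).prod (s m) := by
          refine Commute.list_prod_left _ _ fun y hy => ?_
          obtain ⟨i, hi, rfl⟩ := List.mem_map.1 hy
          refine hs i m ?_ m.lt_succ_self
          have h2 := hlt i (List.mem_append_left _ hi)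
          have h3 : i ≠ m - 1 := by
            rintro rfl
            exact List.disjoint_of_nodup_append hnd hi (List.mem_cons_of_mem _ h)
          omega
        have h2 : Commute ((U₁.map s).prod * (U₂.map s).prod) x := by
          rw [← List.prod_append, ← List.map_append]
          refine Commute.list_prod_left _ _ fun y hy => ?_
          obtain ⟨i, hi, rfl⟩ := List.mem_map.1 hy
          exact hx i (Nat.succ_lt_succ (hlt i hi))
        rw [isConj_iff]
        refine ⟨(U₁.map s).prod * (U₂.map s).prod, ?_⟩
        have h3 : (U₁.map s).prod * (s m * (U₂.map s).prod) * x =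
            s m * x * ((U₁.map s).prod * (U₂.map s).prod) := by
          rw [← mul_assoc, h1.eq, mul_assoc (s m), mul_assoc (s m), h2.eq, ← mul_assoc]
        rw [h3]
        group
      · have h1 : Commute (s m) (U₂.map s).prod := by
          refine Commute.list_prod_right _ _ fun y hy => ?_
          obtain ⟨i, hi, rfl⟩ := List.mem_map.1 hy
          refine (hs i m ?_ m.lt_succ_self).symm
          have h2 := hlt i (List.mem_append_right _ hi)
          have h3 : i ≠ m - 1 := by
            rintro rfl
            exact h hi
          omega
        rw [h1.eq]
        simp only [mul_assoc]
        exact IsConj.refl _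
    refine key.trans ?_
    -- The element `x` absorbs `s m`, which commutes with all generators before `s (m - 1)`.
    have h2 := ih (fun i j hi hj => hs i j hi (hj.trans m.lt_succ_self)) (x := s m * x)
      (fun i hi => (hs i m hi m.lt_succ_self).mul_right (hx i (hi.trans m.lt_succ_self))) hperm
    have h3 : ((List.range (m + 1)).map s).prod = ((List.range m).map s).prod * s m := by
      simp [List.range_succ]
    rwa [h3, mul_assoc]

variable {n : ℕ} [NeZero n]

variable (n) in
/-- The simple generators indexed by natural numbers. -/
def simpleNat (i : ℕ) : B n :=
  if i + 1 < n then refl (pt n i) (pt n (i + 1)) else sgn n i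

theorem simpleB_eq (i : Fin n) : simpleB n i = simpleNat n i := by
  rw [simpleB, simpleNat]
  split_ifs with h
  · rw [signedSwap_eq, mk_eq_pt h, ← mk_eq_pt i.2]
  · rw [signChange_eq, sgn, refl_comm, ← mk_eq_pt i.2]
    rfl

theorem simpleNat_commute {i j : ℕ} (hij : i + 1 < j) (hj : j < n) :
    Commute (simpleNat n i) (simpleNat n j) := by
  have h1 := pt_fst (n := n) (j := i) (by omega)
  have h2 := pt_fst (n := n) (j := i + 1) (by omega)
  have h3 := pt_fst (n := n) hj
  rw [simpleNat, simpleNat, if_pos (by omega)]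
  split_ifs with h
  · have h4 := pt_fst h
    refine refl_mul_refl_comm ?_ ?_ ?_ ?_ <;> rw [Ne, Fin.ext_iff] <;> omega
  · refine refl_mul_refl_comm ?_ ?_ ?_ ?_ <;> rw [Ne, Fin.ext_iff] <;> (try rw [bar_fst]) <;> omega

theorem cyc_zero_eq_prod {L : ℕ} (h : L < n) :
    cyc n 0 L = ((List.range L).map (simpleNat n)).prod := by
  induction L with
  | zero => rfl
  | succ L ih =>
    rw [cyc, ih (by omega), List.range_succ, List.map_append, List.prod_append, List.map_singleton,
      List.prod_singleton, simpleNat, if_pos h, zero_add]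

theorem stdCoxeter_eq_prod : stdCoxeter n = ((List.range n).map (simpleNat n)).prod := by
  obtain ⟨m, hm⟩ : ∃ m, n = m + 1 := ⟨n - 1, (Nat.succ_pred_eq_of_pos (NeZero.pos n)).symm⟩
  rw [stdCoxeter, show n - 1 = m by omega, cyc_zero_eq_prod (by omega)]
  conv_rhs => rw [show List.range n = List.range (m + 1) by rw [← hm]]
  rw [List.range_succ, List.map_append, List.prod_append, List.map_singleton, List.prod_singleton]
  congr 1
  rw [simpleNat, if_neg (by omega)]

theorem IsCoxeterElement.isConj_stdCoxeter {c : B n} (hc : IsCoxeterElement (simpleB n) c) :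
    IsConj c (stdCoxeter n) := by
  obtain ⟨σ, w, rfl⟩ := hc
  have h1 : IsConj (w * (List.ofFn fun i => simpleB n (σ i)).prod * w⁻¹)
      (List.ofFn fun i => simpleB n (σ i)).prod := (isConj_iff.2 ⟨w, rfl⟩).symm
  refine h1.trans ?_
  have h2 : (List.ofFn fun i => simpleB n (σ i)) =
      (List.ofFn fun i => ((σ i : Fin n) : ℕ)).map (simpleNat n) := by
    rw [List.map_ofFn]
    exact congrArg List.ofFn (funext fun i => simpleB_eq _)
  have h3 : (List.ofFn fun i => ((σ i : Fin n) : ℕ)).Perm (List.range n) := by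
    rw [List.perm_ext_iff_of_nodup
      (List.nodup_ofFn.2 fun i j h => σ.injective (Fin.ext h)) List.nodup_range]
    intro a
    rw [List.mem_ofFn, List.mem_range]
    constructor
    · rintro ⟨i, rfl⟩
      exact (σ i).2
    · intro ha
      exact ⟨σ.symm ⟨a, ha⟩, by simp⟩
  have h4 := isConj_prod_of_perm_range (fun i j hi hj => simpleNat_commute hi hj) (x := 1)
    (fun i _ => Commute.one_right _) h3
  rw [mul_one, mul_one] at h4
  rw [h2, stdCoxeter_eq_prod]
  exact h4

end FussB

/-! ### From coefficients in the group algebra to numbers of factorizations. -/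

namespace FussB

variable {n : ℕ}

/-! ### The absolute length is a conjugation invariant length function -/

theorem conj_mem_reflections {t : B n} (g : B n) (ht : t ∈ reflections (simpleB n)) :
    g * t * g⁻¹ ∈ reflections (simpleB n) := by
  obtain ⟨w, i, rfl⟩ := ht
  exact ⟨g * w, i, by group⟩

theorem codim_mul_le (u v : B n) : codim (u * v) ≤ codim u + codim v := by
  obtain ⟨L, hL, hl, rfl⟩ := exists_word n u (fixes_top u)
  obtain ⟨M, hM, hm, rfl⟩ := exists_word n v (fixes_top v)
  rw [← hl, ← hm, ← List.length_append, ← List.prod_append]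
  exact codim_prod_le _ fun t ht => (List.mem_append.1 ht).elim (hL t) (hM t)

theorem codim_conj_le (g u : B n) : codim (g * u * g⁻¹) ≤ codim u := by
  obtain ⟨L, hL, hl, rfl⟩ := exists_word n u (fixes_top u)
  rw [← hl, ← MulAut.conj_apply, map_list_prod, ← List.length_map (as := L) (MulAut.conj g)]
  refine codim_prod_le _ fun t ht => ?_
  obtain ⟨s, hs, rfl⟩ := List.mem_map.1 ht
  exact conj_mem_reflections g (hL s hs)

theorem codim_conj (g u : B n) : codim (g * u * g⁻¹) = codim u := by
  refine (codim_conj_le g u).antisymm ?_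
  have := codim_conj_le g⁻¹ (g * u * g⁻¹)
  rwa [show g⁻¹ * (g * u * g⁻¹) * g⁻¹⁻¹ = u by group] at this

theorem codim_mul_comm (u v : B n) : codim (u * v) = codim (v * u) := by
  rw [← codim_conj v (u * v)]
  congr 1
  group

/-! ### Counting factorizations -/

theorem prod_ofFn_sum_single {K G Y : Type*} [CommRing K] [Monoid G] [Fintype Y] {m : ℕ}
    (g : Fin m → Y → G) (h : Fin m → Y → K) :
    (List.ofFn fun i => ∑ y, MonoidAlgebra.single (g i y) (h i y)).prod =
      ∑ x : Fin m → Y, MonoidAlgebra.single (List.ofFn fun i => g i (x i)).prod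
        (∏ i, h i (x i)) := by
  induction m with
  | zero => simp [MonoidAlgebra.one_def]
  | succ m ih =>
    rw [List.ofFn_succ, List.prod_cons, ih, Finset.sum_mul_sum, ← Finset.sum_product',
      Finset.univ_product_univ, ← (Fin.consEquiv fun _ => Y).sum_comp]
    refine Finset.sum_congr rfl fun p _ => ?_
    simp [MonoidAlgebra.single_mul_single, Fin.prod_univ_succ, List.ofFn_succ, Fin.consEquiv]

theorem lengthGen_top {S : Type*} [CommRing S] (t : S) : lengthGen n t n =
    ∑ w : B n, MonoidAlgebra.single w ((Polynomial.C t * Polynomial.X) ^ codim w) := by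
  classical
  rw [lengthGen, Finset.filter_true_of_mem fun w _ => fixes_top w]

theorem coeff_lengthGen_top {S : Type*} [CommRing S] (t : S) (w : B n) :
    (lengthGen n t n).coeff w = (Polynomial.C t * Polynomial.X) ^ codim w := by
  classical
  rw [lengthGen_top]
  simp [MonoidAlgebra.coeff_sum, MonoidAlgebra.coeff_single, Finsupp.finsetSum_apply,
    Finsupp.single_apply]

/-- The length is conjugation invariant, so these elements are central and the coefficients of their
products are class functions. -/
theorem single_commute_lengthGen {S : Type*} [CommRing S] (t : S) (g : B n) :
    Commute (MonoidAlgebra.single g 1) (lengthGen n t n) := by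
  rw [Commute, SemiconjBy]
  refine MonoidAlgebra.ext (Finsupp.ext fun w => ?_)
  rw [MonoidAlgebra.coeff_single_mul_apply, MonoidAlgebra.coeff_mul_single_apply,
    coeff_lengthGen_top, coeff_lengthGen_top, mul_one, one_mul, codim_mul_comm]

theorem coeff_eq_of_isConj {K G : Type*} [CommRing K] [Group G] {f : MonoidAlgebra K G}
    (hf : ∀ g, Commute (MonoidAlgebra.single g 1) f) {c d : G} (h : IsConj c d) :
    f.coeff c = f.coeff d := by
  obtain ⟨g, rfl⟩ := isConj_iff.1 h
  have := congrArg (fun f => f.coeff (g * c)) (hf g).eq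
  simp only [MonoidAlgebra.coeff_single_mul_apply, MonoidAlgebra.coeff_mul_single_apply, mul_one,
    one_mul, inv_mul_cancel_left] at this
  exact this

-- The monomial with exponents `e` carries the power `X ^ ∑ e`; as `∑ j = n`, extracting degree `n`
-- imposes nothing beyond `e = j`.
open MvPolynomial in
theorem coeff_coeff_prod_C_X_mul_X {l n : ℕ} {e j : Fin (l + 1) → ℕ} (hj : ∑ b, j b = n) :
    MvPolynomial.coeff (Finsupp.equivFunOnFinite.symm j)
      ((∏ b, (Polynomial.C (X b : MvPolynomial (Fin (l + 1)) ℤ) * Polynomial.X) ^ e b).coeff n) =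
      if e = j then 1 else 0 := by
  have h1 : ∏ b, (Polynomial.C (X b : MvPolynomial (Fin (l + 1)) ℤ) * Polynomial.X) ^ e b =
      Polynomial.C (monomial (Finsupp.equivFunOnFinite.symm e) 1) * Polynomial.X ^ ∑ b, e b := by
    simp only [mul_pow, Finset.prod_mul_distrib, Finset.prod_pow_eq_pow_sum, ← map_pow, ← map_prod]
    congr 2
    rw [monomial_eq, C_1, one_mul, Finsupp.prod_fintype _ _ (by simp)]
    rfl
  rw [h1, Polynomial.coeff_C_mul, Polynomial.coeff_X_pow]
  by_cases h : e = j
  · subst h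
    simp [hj]
  · rw [if_neg h]
    split_ifs
    · rw [mul_one, coeff_monomial, if_neg fun h2 => h (Finsupp.equivFunOnFinite.symm.injective h2)]
    · rw [mul_zero, MvPolynomial.coeff_zero]

open MvPolynomial in
theorem coeff_coeff_prod_one_add_pow {l n : ℕ} (N : Fin (l + 1) → ℕ) {j : Fin (l + 1) → ℕ}
    (hj : ∑ b, j b = n) :
    MvPolynomial.coeff (Finsupp.equivFunOnFinite.symm j)
      ((∏ b, (1 + Polynomial.C (X b : MvPolynomial (Fin (l + 1)) ℤ) *
        Polynomial.X) ^ N b).coeff n) =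
      ∏ b, ((N b).choose (j b) : ℤ) := by
  simp only [add_comm (1 : Polynomial (MvPolynomial (Fin (l + 1)) ℤ)), add_pow, one_pow, mul_one]
  rw [Finset.prod_univ_sum, Polynomial.finsetSum_coeff, MvPolynomial.coeff_sum]
  have h1 : ∀ p : Fin (l + 1) → ℕ, MvPolynomial.coeff (Finsupp.equivFunOnFinite.symm j)
      ((∏ b, ((Polynomial.C (X b : MvPolynomial (Fin (l + 1)) ℤ) * Polynomial.X) ^ p b *
        ((N b).choose (p b) : Polynomial (MvPolynomial (Fin (l + 1)) ℤ)))).coeff n) =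
      if p = j then ∏ b, ((N b).choose (j b) : ℤ) else 0 := by
    intro p
    have h2 : (∏ b, ((N b).choose (p b) : Polynomial (MvPolynomial (Fin (l + 1)) ℤ))) =
        Polynomial.C (MvPolynomial.C (∏ b, ((N b).choose (p b) : ℤ))) := by
      simp
    rw [Finset.prod_mul_distrib, h2, Polynomial.coeff_mul_C, mul_comm, MvPolynomial.coeff_C_mul,
      coeff_coeff_prod_C_X_mul_X hj]
    split_ifs with h
    · rw [h, mul_one]
    · rw [mul_zero]
  simp only [h1]
  rw [Finset.sum_ite_eq']
  split_ifs with h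
  · rfl
  · rw [Fintype.mem_piFinset] at h
    push Not at h
    obtain ⟨b, hb⟩ := h
    rw [Finset.mem_range, not_lt] at hb
    exact (Finset.prod_eq_zero (Finset.mem_univ b) (by rw [Nat.choose_eq_zero_of_lt hb]; rfl)).symm

/-- The lengths `(ℓ(c (∏ᵢ ∏ₐ Fₐᵢ)⁻¹), ∑ᵢ ℓ(F₁ᵢ), ∑ᵢ ℓ(F₂ᵢ), …)` of a factorization of `c`. -/
noncomputable def factorLengths (c : B n) {k l : ℕ} (F : Fin l → Fin k → B n) :
    Fin (l + 1) → ℕ :=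
  Fin.cons (codim (c * (List.ofFn fun i => (List.ofFn fun a => F a i).prod).prod⁻¹))
    fun a => ∑ i, codim (F a i)

-- The coefficient of `c` in a product of length generating elements is computed twice: by expansion
-- over all factorizations, and through Jucys–Murphy elements. The variable `T b` marks the `b`-th
-- component of `factorLengths`.
open MvPolynomial in
theorem card_factorLengths_eq [NeZero n] {c : B n} (hc : IsConj c (stdCoxeter n)) (k l : ℕ)
    {j : Fin (l + 1) → ℕ} (hj : ∑ b, j b = n) :
    Nat.card {F : Fin l → Fin k → B n // factorLengths c F = j} =
      n.choose (j 0) * ∏ a : Fin l, (k * n).choose (j a.succ) := by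
  classical
  set T : Fin (l + 1) → MvPolynomial (Fin (l + 1)) ℤ := fun b => X b with hT
  -- One factor for `T 0`, then `k` copies of the list of the other variables, in the order of the
  -- product `∏ᵢ ∏ₐ F a i`.
  set ts : List (MvPolynomial (Fin (l + 1)) ℤ) :=
    T 0 :: (List.ofFn fun _ : Fin k => List.ofFn fun a : Fin l => T a.succ).flatten with hts
  set Z := (ts.map fun t => lengthGen n t n).prod with hZ
  have hcomm : ∀ g, Commute (MonoidAlgebra.single g 1) Z := fun g =>
    Commute.list_prod_right _ _ fun y hy => by
      obtain ⟨t, -, rfl⟩ := List.mem_map.1 hy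
      exact single_commute_lengthGen t g
  have h1 : gradedCoeff Z c n =
      ((∏ b, (1 + Polynomial.C (T b) * Polynomial.X) ^
        (Fin.cons n (fun _ => k * n) : Fin (l + 1) → ℕ) b).coeff n) := by
    rw [gradedCoeff, coeff_eq_of_isConj hcomm hc, ← gradedCoeff, hZ, prod_map_lengthGen ts le_rfl,
      gradedCoeff_stdCoxeter, hts]
    congr 1
    rw [List.map_cons, List.prod_cons, List.map_flatten, List.prod_flatten, List.map_map,
      List.map_ofFn, List.prod_ofFn, Fin.prod_univ_succ, mul_pow, ← Finset.prod_pow]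
    congr 1
    simp only [Function.comp_apply, List.map_ofFn, List.prod_ofFn, Fin.cons_succ,
      Finset.prod_const, Finset.card_univ, Fintype.card_fin]
    rw [← pow_mul, mul_comm k n, Finset.prod_pow]
  have h2 : Z = lengthGen n (T 0) n * ∑ F : Fin k → Fin l → B n,
      MonoidAlgebra.single (List.ofFn fun i => (List.ofFn (F i)).prod).prod
        (∏ i, ∏ a, (Polynomial.C (T a.succ) * Polynomial.X) ^ codim (F i a)) := by
    rw [← prod_ofFn_sum_single (fun (_ : Fin k) (x : Fin l → B n) => (List.ofFn x).prod)
      fun _ x => ∏ a, (Polynomial.C (T a.succ) * Polynomial.X) ^ codim (x a)]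
    rw [hZ, hts, List.map_cons, List.prod_cons, List.map_flatten, List.prod_flatten, List.map_map,
      List.map_ofFn]
    congr 2
    refine congrArg List.ofFn (funext fun i => ?_)
    rw [← prod_ofFn_sum_single (fun (_ : Fin l) (x : B n) => x)
      fun a x => (Polynomial.C (T a.succ) * Polynomial.X) ^ codim x]
    simp only [Function.comp_apply, List.map_ofFn, ← lengthGen_top]
    rfl
  -- The factor marked by `T 0` is forced to be `c` times the inverse of the remaining product.
  have h3 : gradedCoeff Z c n = ∑ F : Fin k → Fin l → B n,
      (∏ b, (Polynomial.C (T b) * Polynomial.X) ^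
        factorLengths c (fun a i => F i a) b).coeff n := by
    rw [h2, Finset.mul_sum, gradedCoeff_sum]
    refine Finset.sum_congr rfl fun F _ => ?_
    rw [gradedCoeff, MonoidAlgebra.coeff_mul_single_apply, coeff_lengthGen_top,
      Fin.prod_univ_succ, Finset.prod_comm]
    simp only [factorLengths, Fin.cons_zero, Fin.cons_succ, Finset.prod_pow_eq_pow_sum]
  have h4 := congrArg (MvPolynomial.coeff (Finsupp.equivFunOnFinite.symm j)) (h3.symm.trans h1)
  rw [MvPolynomial.coeff_sum, coeff_coeff_prod_one_add_pow _ hj, Fin.prod_univ_succ] at h4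
  simp only [hT, coeff_coeff_prod_C_X_mul_X hj, Fin.cons_zero, Fin.cons_succ] at h4
  rw [Finset.sum_boole] at h4
  have h5 : Nat.card {F : Fin l → Fin k → B n // factorLengths c F = j} =
      (Finset.univ.filter fun F : Fin k → Fin l → B n =>
        factorLengths c (fun a i => F i a) = j).card := by
    rw [← Fintype.card_subtype, ← Nat.card_eq_fintype_card]
    exact Nat.card_congr ((Equiv.piComm fun _ _ => B n).subtypeEquiv fun F => Iff.rfl)
  rw [h5]
  exact_mod_cast h4

end FussB

/-! ### The correspondence between multichains and factorizations. -/

namespace FussB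

/-! ### Sequences and their successive quotients -/

section Ratio

variable {G : Type*} {m : ℕ}

/-- The entries of a sequence counted from `0`, continued by `z` beyond the last one. -/
def extend (z : G) (x : Fin m → G) (i : ℕ) : G := if h : i < m then x ⟨i, h⟩ else z

theorem extend_coe (z : G) (x : Fin m → G) (i : Fin m) : extend z x i = x i := dif_pos i.2

theorem extend_of_le (z : G) (x : Fin m → G) {i : ℕ} (h : m ≤ i) : extend z x i = z :=
  dif_neg (not_lt.2 h)

variable [Group G]

/-- The successive quotients of a sequence continued by `z`. -/
def ratio (z : G) (x : Fin m → G) (i : Fin m) : G := (extend z x i)⁻¹ * extend z x (i + 1)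

/-- The sequence is recovered downwards from its known continuation `z`. Over a finite group this
already yields surjectivity, so every array is an array of quotients. -/
theorem ratio_injective (z : G) : Function.Injective (ratio (m := m) z) := by
  intro x y h
  have key : ∀ j i, i + j = m → extend z x i = extend z y i := by
    intro j
    induction j with
    | zero => intro i hi; rw [extend_of_le z x (by omega), extend_of_le z y (by omega)]
    | succ j ih =>
      intro i hi
      have h1 := congrFun h ⟨i, by omega⟩
      rw [ratio, ratio, ih (i + 1) (by omega)] at h1
      exact inv_injective (mul_right_cancel h1)
  funext i
  rw [← extend_coe z x, ← extend_coe z y]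
  exact key (m - i) i (by omega)

theorem ratio_surjective [Finite G] (z : G) : Function.Surjective (ratio (m := m) z) :=
  Finite.surjective_of_injective (ratio_injective z)

theorem prod_ofFn_inv_mul_succ (y : ℕ → G) (m : ℕ) :
    (List.ofFn fun i : Fin m => (y i)⁻¹ * y (i + 1)).prod = (y 0)⁻¹ * y m := by
  induction m with
  | zero => simp
  | succ m ih =>
    rw [List.ofFn_succ', List.concat_eq_append, List.prod_append, List.prod_singleton]
    simp only [Fin.val_castSucc, Fin.val_last]
    rw [ih]
    group

theorem prod_ofFn_ratio (z : G) (x : Fin m → G) :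
    (List.ofFn (ratio z x)).prod = (extend z x 0)⁻¹ * z := by
  have := prod_ofFn_inv_mul_succ (extend z x) m
  rwa [extend_of_le z x le_rfl] at this

theorem prod_ofFn_apply {k : ℕ} (F : Fin m → Fin k → G) (i : Fin k) :
    (List.ofFn F).prod i = (List.ofFn fun a => F a i).prod := by
  have := map_list_prod (Pi.evalMonoidHom (fun _ : Fin k => G) i) (List.ofFn F)
  rw [List.map_ofFn] at this
  exact this

end Ratio

/-- If the triangle inequalities along a sequence add up to an equality, all are equalities. -/
theorem eq_of_triangle_le {A r f : ℕ → ℕ} {l N : ℕ} (hA : ∀ a < l, A a ≤ f a + A (a + 1))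
    (hl : A l = 0) (hr : ∀ a < l, r (a + 1) ≤ r a + f a) (hN : ∀ a ≤ l, N ≤ r a + A a)
    (h0 : r 0 + ∑ a ∈ Finset.range l, f a = N) :
    (∀ a ≤ l, r a + A a = N) ∧ ∀ a < l, A a = f a + A (a + 1) ∧ r (a + 1) = r a + f a := by
  have h1 : ∀ a ≤ l, r a + ∑ b ∈ Finset.Ico a l, f b ≤ N := by
    intro a
    induction a with
    | zero => intro _; rw [← Finset.range_eq_Ico, h0]
    | succ a ih =>
      intro ha
      have h2 := ih (by omega)
      rw [Finset.sum_eq_sum_Ico_succ_bot (by omega)] at h2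
      have := hr a (by omega)
      omega
  have h2 : ∀ j a, a + j = l → A a ≤ ∑ b ∈ Finset.Ico a l, f b := by
    intro j
    induction j with
    | zero =>
      rintro a rfl
      rw [add_zero] at hl
      omega
    | succ j ih =>
      intro a ha
      have h3 := ih (a + 1) (by omega)
      rw [Finset.sum_eq_sum_Ico_succ_bot (by omega)]
      have := hA a (by omega)
      omega
  have h3 : ∀ a ≤ l, r a + A a = N ∧ A a = ∑ b ∈ Finset.Ico a l, f b := by
    intro a ha
    have := h1 a ha
    have := h2 (l - a) a (by omega)
    have := hN a ha
    omega
  refine ⟨fun a ha => (h3 a ha).1, fun a ha => ?_⟩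
  have h4 := h3 a (by omega)
  have h5 := h3 (a + 1) (by omega)
  have h6 := Finset.sum_eq_sum_Ico_succ_bot ha f
  omega

/-! ### Multichains as factorizations -/

variable {n : ℕ}

theorem absLE_iff {u v : B n} :
    AbsLE (simpleB n) u v ↔ codim v = codim u + codim (u⁻¹ * v) := by
  simp only [AbsLE, absLength_eq_codim]

theorem codim_prod_ofFn_le {k : ℕ} (v : Fin k → B n) :
    codim (List.ofFn v).prod ≤ ∑ i, codim (v i) := by
  induction k with
  | zero => simp
  | succ k ih =>
    rw [List.ofFn_succ, List.prod_cons, Fin.sum_univ_succ]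
    exact (codim_mul_le _ _).trans (Nat.add_le_add_left (ih _) _)

/-- Replacing the factors one at a time costs conjugates of the `u i * (v i)⁻¹`, which have the same
length. It bounds the rank growth between neighbours in `Multichain.exists_factors_eq`. -/
theorem codim_prod_mul_inv_prod_le {k : ℕ} (u v : Fin k → B n) :
    codim ((List.ofFn u).prod * (List.ofFn v).prod⁻¹) ≤ ∑ i, codim (u i * (v i)⁻¹) := by
  induction k with
  | zero => simp
  | succ k ih =>
    rw [List.ofFn_succ, List.prod_cons, List.ofFn_succ, List.prod_cons, Fin.sum_univ_succ]
    set U := (List.ofFn fun i : Fin k => u i.succ).prod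
    set V := (List.ofFn fun i : Fin k => v i.succ).prod
    have h1 : u 0 * U * (v 0 * V)⁻¹ = u 0 * (v 0)⁻¹ * (v 0 * (U * V⁻¹) * (v 0)⁻¹) := by group
    rw [h1]
    refine (codim_mul_le _ _).trans ?_
    rw [codim_conj]
    exact Nat.add_le_add_left (ih _ _) _

namespace NCk

variable {c : B n} {k : ℕ}

theorem entry_eq_extend (π : NCk (simpleB n) c k) (i : ℕ) : π.entry i = extend c π.1 i := rfl

theorem delta_eq_ratio (π : NCk (simpleB n) c k) : π.delta = ratio c π.1 := rfl

theorem delta_injective :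
    Function.Injective (delta : NCk (simpleB n) c k → Fin k → B n) := fun _ _ h =>
  Subtype.ext (ratio_injective c h)

theorem codim_entry_succ (π : NCk (simpleB n) c k) (i : Fin k) :
    codim (π.entry (i + 1)) = codim (π.entry i) + codim (π.delta i) := by
  rw [delta, entry_eq_extend π i, extend_coe]
  by_cases h : (i : ℕ) + 1 < k
  · have h2 := absLE_iff.1 (π.2.2 i ⟨i + 1, h⟩ rfl)
    rwa [← extend_coe c π.1 ⟨i + 1, h⟩] at h2
  · have h2 := absLE_iff.1 (π.2.1 i).2
    rwa [entry_eq_extend, extend_of_le _ _ (not_lt.1 h)]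

theorem rk_add_sum_delta (π : NCk (simpleB n) c k) :
    π.rk + ∑ i, codim (π.delta i) = codim c := by
  have h : ∀ m ≤ k, codim (π.entry 0) +
      ∑ i ∈ Finset.range m, codim ((π.entry i)⁻¹ * π.entry (i + 1)) = codim (π.entry m) := by
    intro m
    induction m with
    | zero => intro _; simp
    | succ m ih =>
      intro hm
      rw [Finset.sum_range_succ, ← add_assoc, ih (by omega)]
      exact (π.codim_entry_succ ⟨m, hm⟩).symm
  have h2 := h k le_rfl
  rw [π.entry_eq_extend k, extend_of_le _ _ le_rfl, Finset.sum_range] at h2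
  rw [rk, absLength_eq_codim]
  exact h2

theorem rk_eq (π : NCk (simpleB n) c k) :
    π.rk = codim (c * (List.ofFn π.delta).prod⁻¹) := by
  rw [rk, absLength_eq_codim, delta_eq_ratio, prod_ofFn_ratio, ← entry_eq_extend]
  congr 1
  group

/-- The partial products lead from the first entry to `c` along a path of total length `codim c`.
Such a path is geodesic, so its points form a chain below `c`. -/
theorem exists_delta_eq {δ : Fin k → B n}
    (h : codim (c * (List.ofFn δ).prod⁻¹) + ∑ i, codim (δ i) = codim c) :
    ∃ π : NCk (simpleB n) c k, π.delta = δ := by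
  obtain ⟨y, rfl⟩ := ratio_surjective c δ
  have h0 : c * (List.ofFn (ratio c y)).prod⁻¹ = extend c y 0 := by
    rw [prod_ofFn_ratio]
    group
  obtain ⟨h1, h2⟩ := eq_of_triangle_le (A := fun m => codim ((extend c y m)⁻¹ * c))
    (r := fun m => codim (extend c y m))
    (f := fun m => codim ((extend c y m)⁻¹ * extend c y (m + 1))) (l := k) (N := codim c)
    (fun a _ => by
      refine le_of_eq_of_le ?_ (codim_mul_le _ _)
      congr 1
      group)
    (by simp [extend_of_le])
    (fun a _ => by
      refine le_of_eq_of_le ?_ (codim_mul_le _ _)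
      congr 1
      group)
    (fun a _ => by
      refine le_of_eq_of_le ?_ (codim_mul_le _ _)
      congr 1
      group)
    (by rw [Finset.sum_range, ← h0]; exact h)
  refine ⟨⟨y, fun i => ⟨absLE_iff.2 (by simp), absLE_iff.2 ?_⟩, fun i j hij => absLE_iff.2 ?_⟩, rfl⟩
  · rw [← h1 i i.2.le, extend_coe]
  · have h3 := (h2 i i.2).2
    simp only [hij, extend_coe] at h3
    exact h3

end NCk

namespace Multichain

variable {c : B n} {k l : ℕ}

/-- The delta sequences of a multichain, continued by `1`. -/
noncomputable def deltas (P : Multichain (NCk (simpleB n) c k) l) (a : ℕ) : Fin k → B n :=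
  extend 1 (fun a => (P.1 a).delta) a

/-- The componentwise successive quotients of the delta sequences of a multichain. -/
noncomputable def factors (P : Multichain (NCk (simpleB n) c k) l) : Fin l → Fin k → B n :=
  ratio 1 fun a => ((P.1 a).delta)⁻¹

theorem factors_injective :
    Function.Injective (factors : Multichain (NCk (simpleB n) c k) l → Fin l → Fin k → B n) :=
  fun _ _ h => Subtype.ext <| funext fun a =>
    NCk.delta_injective (inv_injective (congrFun (ratio_injective 1 h) a))

theorem extend_inv (P : Multichain (NCk (simpleB n) c k) l) (a : ℕ) :
    extend 1 (fun a => ((P.1 a).delta)⁻¹) a = (P.deltas a)⁻¹ := by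
  unfold deltas extend
  split_ifs
  · rfl
  · rw [inv_one]

theorem factors_apply (P : Multichain (NCk (simpleB n) c k) l) (a : Fin l) (i : Fin k) :
    P.factors a i = P.deltas a i * (P.deltas (a + 1) i)⁻¹ := by
  rw [factors, ratio, extend_inv, extend_inv, inv_inv]
  rfl

theorem prod_factors (P : Multichain (NCk (simpleB n) c k) l) (i : Fin k) :
    (List.ofFn fun a => P.factors a i).prod = P.deltas 0 i := by
  rw [← prod_ofFn_apply, factors, prod_ofFn_ratio, extend_inv, inv_inv, mul_one]

theorem codim_deltas (P : Multichain (NCk (simpleB n) c k) l) (a : Fin l) (i : Fin k) :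
    codim (P.deltas a i) = codim (P.factors a i) + codim (P.deltas (a + 1) i) := by
  rw [factors_apply]
  by_cases h : (a : ℕ) + 1 < l
  · have h1 := absLE_iff.1 (P.2 a ⟨a + 1, h⟩ rfl i)
    have h2 : P.deltas (a + 1) = (P.1 ⟨a + 1, h⟩).delta := extend_coe _ _ ⟨a + 1, h⟩
    have h3 : P.deltas a = (P.1 a).delta := extend_coe _ _ a
    rw [h2, h3, h1, add_comm, codim_mul_comm]
  · have h2 : P.deltas (a + 1) = 1 := extend_of_le _ _ (not_lt.1 h)
    simp [h2]

/-- The rank of the `m`-th element of a multichain, and `n` beyond the last one. -/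
theorem rank_eq (hc : codim c = n) (P : Multichain (NCk (simpleB n) c k) l) (m : ℕ) :
    (if h : m < l then ((P.1 ⟨m, h⟩).rk : ℤ) else n) =
      n - ((∑ i, codim (P.deltas m i) : ℕ) : ℤ) := by
  split_ifs with h
  · have h1 := (P.1 ⟨m, h⟩).rk_add_sum_delta
    have h2 : P.deltas m = (P.1 ⟨m, h⟩).delta := extend_coe _ _ ⟨m, h⟩
    rw [h2]
    omega
  · have h2 : P.deltas m = 1 := extend_of_le _ _ (not_lt.1 h)
    simp [h2]

theorem rankJump_zero (hl : 1 ≤ l) (P : Multichain (NCk (simpleB n) c k) l) :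
    rankJump P 0 = (P.1 ⟨0, hl⟩).rk := by
  rw [rankJump]
  simp only [Fin.cons_succ, Fin.castSucc_zero, Fin.cons_zero, sub_zero]
  rw [Fin.snoc, dif_pos (show ((0 : Fin (l + 1)) : ℕ) < l from hl)]
  rfl

theorem rankJump_succ (P : Multichain (NCk (simpleB n) c k) l) (a : Fin l) :
    rankJump P a.succ =
      (if h : (a : ℕ) + 1 < l then ((P.1 ⟨a + 1, h⟩).rk : ℤ) else n) - (P.1 a).rk := by
  rw [rankJump]
  simp only [Fin.cons_succ, ← Fin.succ_castSucc, Fin.snoc_castSucc]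
  rfl

theorem rankJump_eq (hc : codim c = n) (hl : 1 ≤ l) (P : Multichain (NCk (simpleB n) c k) l)
    (i : Fin (l + 1)) : rankJump P i = factorLengths c P.factors i := by
  induction i using Fin.cases with
  | zero =>
    have h2 : P.deltas 0 = (P.1 ⟨0, hl⟩).delta := extend_coe _ _ ⟨0, hl⟩
    simp only [rankJump_zero hl, factorLengths, Fin.cons_zero, prod_factors, NCk.rk_eq, h2]
  | succ a =>
    have h1 : factorLengths c P.factors a.succ = ∑ i, codim (P.factors a i) := rfl
    have h2 := P.rank_eq hc a
    rw [dif_pos a.2] at h2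
    rw [h1, rankJump_succ, rank_eq hc, h2, Finset.sum_congr rfl fun i _ => P.codim_deltas a i,
      Finset.sum_add_distrib]
    push_cast
    ring

theorem sum_factorLengths (hc : codim c = n) (hl : 1 ≤ l)
    (P : Multichain (NCk (simpleB n) c k) l) : ∑ i, factorLengths c P.factors i = n := by
  have h : ∀ m ≤ l, ∑ i, codim (P.deltas 0 i) =
      ∑ a ∈ Finset.range m, ∑ i, codim (P.deltas a i * (P.deltas (a + 1) i)⁻¹) +
        ∑ i, codim (P.deltas m i) := by
    intro m
    induction m with
    | zero => intro _; simp
    | succ m ih =>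
      intro hm
      have h1 : ∀ i, codim (P.deltas m i) = codim (P.deltas m i * (P.deltas (m + 1) i)⁻¹) +
          codim (P.deltas (m + 1) i) := fun i => by
        rw [P.codim_deltas ⟨m, hm⟩ i, factors_apply]
      rw [ih (by omega), Finset.sum_range_succ, add_assoc, ← Finset.sum_add_distrib,
        Finset.sum_congr rfl fun i _ => h1 i]
  have h2 := h l le_rfl
  have h3 : P.deltas l = 1 := extend_of_le _ _ le_rfl
  have h4 : P.deltas 0 = (P.1 ⟨0, hl⟩).delta := extend_coe _ _ ⟨0, hl⟩
  have h5 := (P.1 ⟨0, hl⟩).rk_add_sum_delta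
  rw [Finset.sum_range] at h2
  simp only [h3, Pi.one_apply, codim_one, Finset.sum_const_zero, add_zero, ← factors_apply] at h2
  rw [Fin.sum_univ_succ]
  simp only [factorLengths, Fin.cons_zero, Fin.cons_succ, prod_factors]
  rw [← h2, h4, ← NCk.rk_eq, h5, hc]

/-- In `eq_of_triangle_le`, `r a` is the length of the prospective first entry of the `a`-th element
and `A a` the total length of its delta sequence. The equality `r a + A a = n` makes each `(e a)⁻¹`
a genuine delta sequence, and sharpness of the steps gives the order relations. -/
theorem exists_factors_eq (hc : codim c = n) {F : Fin l → Fin k → B n}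
    (hF : ∑ i, factorLengths c F i = n) :
    ∃ P : Multichain (NCk (simpleB n) c k) l, P.factors = F := by
  obtain ⟨x, rfl⟩ := ratio_surjective (1 : Fin k → B n) F
  set e : ℕ → Fin k → B n := extend 1 x with he
  have hstep : ∀ a i, codim ((e a)⁻¹ i) ≤
      codim (((e a)⁻¹ * e (a + 1)) i) + codim ((e (a + 1))⁻¹ i) := fun a i => by
    refine le_of_eq_of_le ?_ (codim_mul_le _ _)
    simp
  have h00 : (List.ofFn fun i => (List.ofFn fun a => ratio 1 x a i).prod) =
      List.ofFn ((e 0)⁻¹ : Fin k → B n) := by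
    refine congrArg List.ofFn (funext fun i => ?_)
    rw [← prod_ofFn_apply, prod_ofFn_ratio, mul_one]
  obtain ⟨h1, h2⟩ := eq_of_triangle_le (A := fun a => ∑ i, codim ((e a)⁻¹ i))
    (r := fun a => codim (c * (List.ofFn ((e a)⁻¹ : Fin k → B n)).prod⁻¹))
    (f := fun a => ∑ i, codim (((e a)⁻¹ * e (a + 1)) i)) (l := l) (N := codim c)
    (fun a _ => by
      rw [← Finset.sum_add_distrib]
      exact Finset.sum_le_sum fun i _ => hstep a i)
    (by simp [he, extend_of_le])
    (fun a _ => by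
      refine le_trans ?_ (Nat.add_le_add_left (le_of_le_of_eq (codim_prod_mul_inv_prod_le
        ((e a)⁻¹ : Fin k → B n) ((e (a + 1))⁻¹ : Fin k → B n)) (by simp)) _)
      refine le_of_eq_of_le ?_ (codim_mul_le _ _)
      congr 1
      group)
    (fun a _ => by
      refine le_trans ?_ (Nat.add_le_add_left (codim_prod_ofFn_le _) _)
      refine le_of_eq_of_le ?_ (codim_mul_le _ _)
      congr 1
      group)
    (by
      rw [Finset.sum_range, hc]
      refine Eq.trans ?_ hF
      rw [Fin.sum_univ_succ]
      simp only [factorLengths, Fin.cons_zero, Fin.cons_succ, h00]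
      rfl)
  have h3 : ∀ a : Fin l, ∃ π : NCk (simpleB n) c k, π.delta = (e a)⁻¹ := fun a =>
    NCk.exists_delta_eq (h1 a a.2.le)
  choose π hπ using h3
  refine ⟨⟨π, ?_⟩, ?_⟩
  · intro a b hab i
    rw [absLE_iff, hπ, hπ, ← hab]
    have h4 := (h2 a a.2).1
    simp only [← Finset.sum_add_distrib] at h4
    -- The inequalities hold for each `i`, so equality of the sums forces equality in every
    -- component.
    have h5 := (Finset.sum_eq_sum_iff_of_le fun i _ => hstep a i).1 h4 i (Finset.mem_univ i)
    rw [h5, add_comm, Pi.mul_apply, codim_mul_comm, Pi.inv_apply (e (a + 1)), inv_inv]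
  · refine congrArg (ratio 1) (funext fun a => ?_)
    rw [hπ, inv_inv]
    exact extend_coe _ _ a

end Multichain

/-! ### The three enumerations. -/

theorem IsCoxeterElement.codim_eq [NeZero n] {c : B n} (hc : IsCoxeterElement (simpleB n) c) :
    codim c = n := by
  obtain ⟨g, hg⟩ := isConj_iff.1 hc.isConj_stdCoxeter
  rw [← codim_conj g, hg, codim_stdCoxeter]

theorem card_rankJump_eq [NeZero n] {c : B n} (hc : IsCoxeterElement (simpleB n) c) (k : ℕ) {l : ℕ}
    (hl : 1 ≤ l) {j : Fin (l + 1) → ℕ} (hj : ∑ i, j i = n) :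
    Nat.card {P : Multichain (NCk (simpleB n) c k) l // ∀ i, rankJump P i = (j i : ℤ)} =
      n.choose (j 0) * ∏ i : Fin l, (k * n).choose (j i.succ) := by
  rw [← card_factorLengths_eq hc.isConj_stdCoxeter k l hj]
  have h : ∀ P : Multichain (NCk (simpleB n) c k) l,
      (∀ i, rankJump P i = (j i : ℤ)) ↔ factorLengths c P.factors = j := fun P => by
    rw [funext_iff]
    exact forall_congr' fun i => by rw [Multichain.rankJump_eq hc.codim_eq hl, Nat.cast_inj]
  refine Nat.card_eq_of_bijective (fun P => ⟨P.1.factors, (h P.1).1 P.2⟩) ⟨?_, ?_⟩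
  · intro P Q hPQ
    exact Subtype.ext (Multichain.factors_injective (congrArg Subtype.val hPQ))
  · rintro ⟨F, hF⟩
    obtain ⟨P, rfl⟩ := Multichain.exists_factors_eq (k := k) hc.codim_eq (F := F) (by rw [hF, hj])
    exact ⟨⟨P, (h P).2 hF⟩, rfl⟩

/-- Vandermonde's identity for several factors. -/
theorem sum_prod_choose {ι : Type*} [DecidableEq ι] (s : Finset ι) (N : ι → ℕ) (m : ℕ) :
    ∑ j ∈ s.finsuppAntidiag m, ∏ i ∈ s, (N i).choose (j i) = (∑ i ∈ s, N i).choose m := by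
  have h : ∀ N m : ℕ,
      PowerSeries.coeff m ((1 + PowerSeries.X : PowerSeries ℤ) ^ N) = N.choose m := by
    intro N m
    have := Polynomial.coeff_coe ((1 + Polynomial.X : Polynomial ℤ) ^ N) m
    rw [Polynomial.coeff_one_add_X_pow] at this
    rw [← this]
    simp
  have h2 := h (∑ i ∈ s, N i) m
  rw [← Finset.prod_pow_eq_pow_sum, PowerSeries.coeff_prod] at h2
  simp only [h] at h2
  exact_mod_cast h2

/-- Summing over all rank-jump vectors is a Vandermonde sum with upper indices `n` and `l` times `k
* n`, of total `(k * l + 1) * n`. -/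
theorem zeta_eq [NeZero n] {c : B n} (hc : IsCoxeterElement (simpleB n) c) (k : ℕ) {l : ℕ}
    (hl : 1 ≤ l) : zeta (NCk (simpleB n) c k) l = ((k * l + 1) * n).choose n := by
  classical
  have : Finite (Multichain (NCk (simpleB n) c k) l) :=
    Finite.of_injective _ Multichain.factors_injective
  have := Fintype.ofFinite (Multichain (NCk (simpleB n) c k) l)
  have h1 := Finset.card_eq_sum_card_fiberwise (s := Finset.univ)
    (t := (Finset.univ : Finset (Fin (l + 1))).finsuppAntidiag n)
    (f := fun P : Multichain (NCk (simpleB n) c k) l =>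
      Finsupp.equivFunOnFinite.symm (factorLengths c P.factors))
    (fun P _ => by
      rw [Finset.mem_coe, Finset.mem_finsuppAntidiag]
      exact ⟨P.sum_factorLengths hc.codim_eq hl, Finset.subset_univ _⟩)
  rw [zeta, Nat.card_eq_fintype_card, ← Finset.card_univ, h1]
  have h2 : ∀ j ∈ (Finset.univ : Finset (Fin (l + 1))).finsuppAntidiag n,
      (Finset.univ.filter fun P : Multichain (NCk (simpleB n) c k) l =>
        Finsupp.equivFunOnFinite.symm (factorLengths c P.factors) = j).card =
      ∏ i, ((Fin.cons n fun _ => k * n : Fin (l + 1) → ℕ) i).choose (j i) := by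
    intro j hj
    rw [Finset.mem_finsuppAntidiag] at hj
    rw [Fin.prod_univ_succ]
    simp only [Fin.cons_zero, Fin.cons_succ]
    rw [← card_rankJump_eq hc k hl hj.1, ← Fintype.card_subtype, ← Nat.card_eq_fintype_card]
    refine Nat.card_congr (Equiv.subtypeEquivRight fun P => ?_)
    rw [Equiv.symm_apply_eq, funext_iff]
    exact forall_congr' fun i => by
      rw [Multichain.rankJump_eq hc.codim_eq hl, Nat.cast_inj]; rfl
  rw [Finset.sum_congr rfl h2, sum_prod_choose, Fin.sum_univ_succ]
  simp only [Fin.cons_zero, Fin.cons_succ, Finset.sum_const, Finset.card_univ, Fintype.card_fin,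
    smul_eq_mul]
  congr 1
  ring

/-- An element of rank `i` is a multichain with `l = 1` and rank-jump vector `(i, n - i)`. -/
theorem fussNarayana_eq [NeZero n] {c : B n} (hc : IsCoxeterElement (simpleB n) c) (k : ℕ) {i : ℕ}
    (hi : i ≤ n) :
    fussNarayana (simpleB n) c k i = n.choose i * (k * n).choose (n - i) := by
  have h := card_rankJump_eq hc k le_rfl (j := ![i, n - i]) (by simp; omega)
  simp only [Matrix.cons_val_zero, Fin.prod_univ_one, Fin.succ_zero_eq_one,
    Matrix.cons_val_one] at h
  rw [← h, fussNarayana]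
  refine Nat.card_congr (Equiv.symm ?_)
  refine Equiv.subtypeEquiv ?_ ?_
  · exact
      { toFun := fun P => P.1 0
        invFun := fun π => ⟨fun _ => π, fun a b hab => by omega⟩
        left_inv := fun P => Subtype.ext (funext fun a => by rw [Subsingleton.elim a 0])
        right_inv := fun _ => rfl }
  · intro P
    rw [Fin.forall_fin_two]
    have h0 : rankJump P 0 = (P.1 0).rk := P.rankJump_zero le_rfl
    have h1 : rankJump P 1 = n - (P.1 0).rk := P.rankJump_succ 0
    change _ ↔ (P.1 0).rk = i
    rw [h0, h1]
    simp only [Matrix.cons_val_zero, Matrix.cons_val_one]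
    omega

end FussB

theorem mainTheorem12 (n k : ℕ) (hn : 1 ≤ n) (hk : 1 ≤ k) (c : FussB.B n)
    (hc : FussB.IsCoxeterElement (FussB.simpleB n) c) :
    (∀ l : ℕ, 1 ≤ l → ∀ j : Fin (l + 1) → ℕ, ∑ i, j i = n →
      Nat.card {P : FussB.Multichain (FussB.NCk (FussB.simpleB n) c k) l //
          ∀ i, FussB.rankJump P i = (j i : ℤ)} =
        n.choose (j 0) * ∏ i : Fin l, (k * n).choose (j i.succ)) ∧
    (∀ l : ℕ, 1 ≤ l →
      FussB.zeta (FussB.NCk (FussB.simpleB n) c k) l = ((k * l + 1) * n).choose n) ∧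
    (∀ i : ℕ, i ≤ n →
      FussB.fussNarayana (FussB.simpleB n) c k i = n.choose i * (k * n).choose (n - i)) := by
  have : NeZero n := ⟨by omega⟩
  exact ⟨fun l hl j hj => FussB.card_rankJump_eq hc k hl hj, fun l hl => FussB.zeta_eq hc k hl,
    fun i hi => FussB.fussNarayana_eq hc k hi⟩
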